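/- Let $K\ge 2$ and $r_1,\dots,r_K$ be fixed, and let $\mathcal X_t=\mathcal F_{0t}\times_1\mathbf A_{01}\times_2\cdots\times_K\mathbf A_{0K}+\mathcal E_t\in\mathbb R^{p_1\times\cdots\times p_K}$, $1\le t\le T$, with non-random $\mathcal F_{0t}\in\mathbb R^{r_1\times\cdots\times r_K}$ and $\mathbf A_{0k}\in\mathbb R^{p_k\times r_k}$. Write $\mathbf X_{k,t},\mathbf F_{0k,t}$ for the mode-$k$ unfoldings of $\mathcal X_t,\mathcal F_{0t}$, $p=\prod_k p_k$, $p_{-k}=p/p_k$, and $\lambda_j$ for the $j$-th largest eigenvalue. **Assumption 1.** (i) There are closed sets $\mathcal A_k\subset\mathbb R^{r_k}$, $\mathcal F\subset\mathbb R^{r_1\times\cdots\times r_K}$ such that the rows of $\mathbf A_{0k}$ lie in $\mathcal A_k$, $\mathcal F_{0t}\in\mathcal F$, $\mathbf A_{0k}^\top\mathbf A_{0k}/p_k=\mathbf I_{r_k}$, and $\frac1T\sum_{t}\mathbf F_{0k,t}\mathbf F_{0k,t}^\top$ is a positive diagonal matrix with non-increasing diagonal, for every $k$; (ii) $\|\mathbf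 A_{0k}\|_F=c_kp_k^{1/2}$ with constants $0<c_k<\infty$; (iii) $\frac1T\sum_{t}\mathbf F_{0k,t}\mathbf F_{0k,t}^\top\to\boldsymbol\Sigma_{0k}$, a positive definite diagonal matrix with non-increasing diagonal. **Assumption 2.** The entries $e_{t,i_1,\dots,i_K}$ of $\mathcal E_t$ are independent across $t$ and $i_1,\dots,i_K$. **Assumption 3.** (i) $\mathbb E\,e_{t,i_1,\dots,i_K}=0$; (ii) there is $\nu>0$ with $\mathbb E|e_{t,i_1,\dots,i_K}|^{2d}\le\frac{(2d)!}{2^dd!}\nu^{2d}$ for all $d\ge1$ and all $t,i_1,\dots,i_K$, at all sample sizes; (iii) $\|\mathcal E_t\|_F>0$ a.s. for all $t$. **Estimator (iPE-ER).** Fix an integer $r_{\max}>\max_kr_k$ and a constant $0<c<\infty$, and put $L=\min\{p,Tp_{-1},\dots,Tp_{-K}\}$, $\omega_k=\min\{p_kT,p_{-k}^2,L\}$. Let $\widehat{\mathbf A}^{(0)}_k$ be $\sqrt{p_k}$ times the matrix of the first $r_{\max}$ orthonormal eigenvectors of $\frac1{Tp}\sum_t\mathbf X_{k,t}\mathbf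 X_{k,t}^\top$. In sweep $s=1,2,\dots$, for $k=1,\dots,K$ in turn, let $\widehat{\mathbf B}^{(s)}_k$ be the Kronecker product of the $\widehat{\mathbf A}_j^{(s-1)}$, $j>k$, and the $\widehat{\mathbf A}_j^{(s)}$, $j<k$, and let $$\widehat{\mathbf M}^{(s)}_k=\frac1{Tpp_{-k}}\sum_{t=1}^T\mathbf X_{k,t}\widehat{\mathbf B}^{(s)}_k\widehat{\mathbf B}_k^{(s)\top}\mathbf X_{k,t}^\top,\qquad \widehat r^{(s)}_k\in\operatorname*{argmax}_{1\le j\le r_{\max}}\frac{\lambda_j(\widehat{\mathbf M}^{(s)}_k)}{\lambda_{j+1}(\widehat{\mathbf M}^{(s)}_k)+c\,\omega_k^{-1/2}};$$ then let $\widehat{\mathbf A}^{(s)}_k$ be $\sqrt{p_k}$ times the matrix of the first $\widehat r^{(s)}_k+2$ orthonormal eigenvectors of $\widehat{\mathbf M}^{(s)}_k$. (If more than $p_k$ eigenvectors are asked for, all $p_k$ are taken; $\lambda_j=0$ for $j>p_k$; ties are broken arbitrarily.) The algorithm stops after some, possibly data-dependent, number $S\ge1$ of sweeps, and $\widehat r_k^{\text{iPE-ER}}=\widehat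 r_k^{(S)}$. **Theorem.** Under Assumptions 1–3, for all $1\le k\le K$, $$\lim_{\min\{T,p_1,\dots,p_K\}\to\infty}\mathbb P\left(\widehat r_k^{\text{iPE-ER}}=r_k\right)=1,$$ that is, the limit holds along every sequence of $(T,p_1,\dots,p_K)$ all of whose components tend to infinity; no condition is needed on their relative rates of divergence. (The true parameters and the probability space may vary along the sequence, with $\mathcal A_k,\mathcal F,c_k,\boldsymbol\Sigma_{0k},\nu$ fixed.) -/

import Mathlib

open MeasureTheory ProbabilityTheory Filter Topology
open scoped Matrix

noncomputable section

namespace TensorFactor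

/-- Real tensors of order `K` and size `d 0 × ⋯ × d (K - 1)`. -/
abbrev Tensor {K : ℕ} (d : Fin K → ℕ) : Type := ((k : Fin K) → Fin (d k)) → ℝ

/-- Multi-indices over all modes except `k`; they index the mode-`k` fibres. -/
abbrev CoIndex {K : ℕ} (d : Fin K → ℕ) (k : Fin K) : Type :=
  (l : {l : Fin K // l ≠ k}) → Fin (d l)

/-- The Frobenius norm of a tensor. -/
def tensorNorm {K : ℕ} {d : Fin K → ℕ} (X : Tensor d) : ℝ := √(∑ i, X i ^ 2)

/-- The Frobenius norm of a matrix. -/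
def frobNorm {m n : Type} [Fintype m] [Fintype n] (A : Matrix m n ℝ) : ℝ :=
  √(∑ i, ∑ j, A i j ^ 2)

/-- The multilinear product `F ×₁ A₁ ×₂ ⋯ ×_K A_K`. -/
def modeProd {K : ℕ} {r d : Fin K → ℕ} (F : Tensor r)
    (A : ∀ k, Matrix (Fin (d k)) (Fin (r k)) ℝ) : Tensor d :=
  fun i => ∑ j, F j * ∏ k, A k (i k) (j k)

/-- The mode-`k` unfolding `mat_k X`, of size `d k × ∏_{l ≠ k} d l`; its columns are the mode-`k`
fibres, labelled by the indices of the other modes. -/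
def unfolding {K : ℕ} {d : Fin K → ℕ} (k : Fin K) (X : Tensor d) :
    Matrix (Fin (d k)) (CoIndex d k) ℝ :=
  Matrix.of fun a b => X ((Equiv.piSplitAt k (fun l => Fin (d l))).symm (a, b))

/-- The Kronecker product of all `A_l`, `l ≠ k`, with rows and columns labelled by multi-indices
(rows in the same way as the columns of `unfolding k`). -/
def kronExcept {K : ℕ} {d m : Fin K → ℕ} (k : Fin K)
    (A : ∀ l, Matrix (Fin (d l)) (Fin (m l)) ℝ) : Matrix (CoIndex d k) (CoIndex m k) ℝ :=
  Matrix.of fun i j => ∏ l : {l : Fin K // l ≠ k}, A l (i l) (j l)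

/-- `p = p₁ ⋯ p_K`. -/
def fullDim {K : ℕ} (d : Fin K → ℕ) : ℕ := ∏ k, d k

/-- `p_{-k} = ∏_{l ≠ k} p_l`. -/
def coDim {K : ℕ} (d : Fin K → ℕ) (k : Fin K) : ℕ := ∏ l ∈ Finset.univ.erase k, d l

/-- `L = min {p, T p_{-1}, …, T p_{-K}}`. -/
def rateL {K : ℕ} (T : ℕ) (d : Fin K → ℕ) : ℕ := min (fullDim d) (⨅ k, T * coDim d k)

/-- `ω_k = min {p_k T, p_{-k}², L}`. -/
def rateOmega {K : ℕ} (T : ℕ) (d : Fin K → ℕ) (k : Fin K) : ℕ :=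
  min (min (d k * T) (coDim d k ^ 2)) (rateL T d)

/-! ### Model and assumptions -/

/-- `T⁻¹ ∑_t F_{k,t} F_{k,t}ᵀ`. -/
def factorCov {K T : ℕ} {r : Fin K → ℕ} (F : Fin T → Tensor r) (k : Fin K) :
    Matrix (Fin (r k)) (Fin (r k)) ℝ :=
  (1 / (T : ℝ)) • ∑ t, unfolding k (F t) * (unfolding k (F t))ᵀ

/-- Positive definite diagonal matrices with non-increasing diagonal. -/
def IsPosDecDiagonal {m : ℕ} (M : Matrix (Fin m) (Fin m) ℝ) : Prop :=
  ∃ σ : Fin m → ℝ, (∀ i, 0 < σ i) ∧ Antitone σ ∧ M = Matrix.diagonal σ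

/-- The parameter space `Θ`: the rows of `A_k` lie in `𝒜_k`, `A_kᵀ A_k / p_k = I`, the `F_t` lie
in `ℱ` and `T⁻¹ ∑_t F_{k,t} F_{k,t}ᵀ` is positive diagonal with non-increasing diagonal. -/
def paramSpace {K : ℕ} {r : Fin K → ℕ} (𝒜 : ∀ k, Set (Fin (r k) → ℝ)) (ℱ : Set (Tensor r))
    (T : ℕ) (d : Fin K → ℕ) :
    Set ((∀ k, Matrix (Fin (d k)) (Fin (r k)) ℝ) × (Fin T → Tensor r)) :=
  {θ | (∀ k j, θ.1 k j ∈ 𝒜 k) ∧ (∀ k, (1 / (d k : ℝ)) • ((θ.1 k)ᵀ * θ.1 k) = 1) ∧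
    (∀ t, θ.2 t ∈ ℱ) ∧ ∀ k, IsPosDecDiagonal (factorCov θ.2 k)}

/-- The assumption on true loadings and (non-random) true factors, along a sequence of sample
sizes `T n` and dimensions `p n`. -/
structure LoadingFactorAssumption {K : ℕ} {r : Fin K → ℕ}
    (𝒜 : ∀ k, Set (Fin (r k) → ℝ)) (ℱ : Set (Tensor r)) (T : ℕ → ℕ) (p : ℕ → Fin K → ℕ)
    (A₀ : ∀ n k, Matrix (Fin (p n k)) (Fin (r k)) ℝ)
    (F₀ : ∀ n, Fin (T n) → Tensor r) : Prop where
  closed_loadings : ∀ k, IsClosed (𝒜 k)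
  closed_factors : IsClosed ℱ
  mem_paramSpace : ∀ n, (A₀ n, F₀ n) ∈ paramSpace 𝒜 ℱ (T n) (p n)
  pervasive : ∀ k, ∃ a : ℝ, 0 < a ∧ ∀ n, frobNorm (A₀ n k) = a * √(p n k : ℝ)
  factorCov_tendsto : ∀ k, ∃ Sig : Matrix (Fin (r k)) (Fin (r k)) ℝ,
    IsPosDecDiagonal Sig ∧ Tendsto (fun n => factorCov (F₀ n) k) atTop (𝓝 Sig)

/-- For each sample, the idiosyncratic errors `e_{t,i₁,…,i_K}` are independent across `t` and
`i₁, …, i_K`. -/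
def ErrorIndependence {K : ℕ} (T : ℕ → ℕ) (p : ℕ → Fin K → ℕ) {Ω : ℕ → Type*}
    [∀ n, MeasurableSpace (Ω n)] (P : ∀ n, Measure (Ω n))
    (E : ∀ n, Fin (T n) → Ω n → Tensor (p n)) : Prop :=
  ∀ n, iIndepFun (fun (ti : Fin (T n) × ((k : Fin K) → Fin (p n k))) ω => E n ti.1 ω ti.2) (P n)

/-- Centred errors with uniformly sub-Gaussian even moments, and almost surely nonzero error
tensors. -/
structure SubGaussianErrors {K : ℕ} (T : ℕ → ℕ) (p : ℕ → Fin K → ℕ) {Ω : ℕ → Type*}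
    [∀ n, MeasurableSpace (Ω n)] (P : ∀ n, Measure (Ω n))
    (E : ∀ n, Fin (T n) → Ω n → Tensor (p n)) : Prop where
  centred : ∀ n t i, Integrable (fun ω => E n t ω i) (P n) ∧ ∫ ω, E n t ω i ∂(P n) = 0
  moments : ∃ ν : ℝ, 0 < ν ∧ ∀ n t i (d : ℕ), 1 ≤ d →
    Integrable (fun ω => |E n t ω i| ^ (2 * d)) (P n) ∧
    ∫ ω, |E n t ω i| ^ (2 * d) ∂(P n) ≤
      ((2 * d).factorial : ℝ) / (2 ^ d * (d.factorial : ℝ)) * ν ^ (2 * d)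
  nonzero : ∀ n t, ∀ᵐ ω ∂(P n), 0 < tensorNorm (E n t ω)

/-- The data `X_t = F_t ×₁ A₁ ×₂ ⋯ ×_K A_K + E_t`. -/
def observations {K T : ℕ} {r d : Fin K → ℕ} (A : ∀ k, Matrix (Fin (d k)) (Fin (r k)) ℝ)
    (F : Fin T → Tensor r) (E : Fin T → Tensor d) : Fin T → Tensor d :=
  fun t => modeProd (F t) A + E t

/-! ### The estimator -/

/-- `λ_j(M)`, `j = 1, 2, …`: the `j`-th largest eigenvalue, with multiplicity, of a symmetric
`q × q` matrix (and `0` for `j > q`). -/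
def eigval {q : ℕ} (M : Matrix (Fin q) (Fin q) ℝ) (j : ℕ) : ℝ :=
  open Classical in
  if h : M.IsHermitian ∧ j - 1 < Fintype.card (Fin q) then h.1.eigenvalues₀ ⟨j - 1, h.2⟩ else 0

/-- `A` is `√q` times a matrix whose columns are the first `m` orthonormal eigenvectors of the
`q × q` matrix `M`, ordered by decreasing eigenvalue (any choice of them). -/
def IsLeadingEigenvectors {q m : ℕ} (M : Matrix (Fin q) (Fin q) ℝ)
    (A : Matrix (Fin q) (Fin m) ℝ) : Prop :=
  ∃ U : Matrix (Fin q) (Fin m) ℝ, Uᵀ * U = 1 ∧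
    (∀ j : Fin m, M *ᵥ U.col j = eigval M (j + 1) • U.col j) ∧ A = √(q : ℝ) • U

/-- The unprojected matrix `(T p)⁻¹ ∑_t X_{k,t} X_{k,t}ᵀ`. -/
def sampleCov {K T : ℕ} {d : Fin K → ℕ} (X : Fin T → Tensor d) (k : Fin K) :
    Matrix (Fin (d k)) (Fin (d k)) ℝ :=
  (1 / ((T : ℝ) * fullDim d)) • ∑ t, unfolding k (X t) * (unfolding k (X t))ᵀ

/-- The projected matrix `(T p p_{-k})⁻¹ ∑_t X_{k,t} B_k B_kᵀ X_{k,t}ᵀ`, where `B_k` is the Kronecker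
product of the `A_l`, `l ≠ k`. -/
def projCov {K T : ℕ} {d m : Fin K → ℕ} (X : Fin T → Tensor d) (k : Fin K)
    (A : ∀ l, Matrix (Fin (d l)) (Fin (m l)) ℝ) : Matrix (Fin (d k)) (Fin (d k)) ℝ :=
  (1 / ((T : ℝ) * fullDim d * coDim d k)) •
    ∑ t, unfolding k (X t) * kronExcept k A * (kronExcept k A)ᵀ * (unfolding k (X t))ᵀ

/-- The penalized eigenvalue ratio `λ_j(M) / (λ_{j+1}(M) + δ)`. -/
def eigRatio {q : ℕ} (M : Matrix (Fin q) (Fin q) ℝ) (δ : ℝ) (j : ℕ) : ℝ :=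
  eigval M j / (eigval M (j + 1) + δ)

/-- `ρ` maximizes the penalized eigenvalue ratio of `M` over `1 ≤ j ≤ rmax`. -/
def IsRatioArgmax {q : ℕ} (M : Matrix (Fin q) (Fin q) ℝ) (δ : ℝ) (rmax ρ : ℕ) : Prop :=
  ρ ∈ Finset.Icc 1 rmax ∧ ∀ j ∈ Finset.Icc 1 rmax, eigRatio M δ j ≤ eigRatio M δ ρ

/-- While mode `k` is treated in sweep `s + 1`, the modes `l < k` are already updated. -/
def sweepIndex {K : ℕ} (s : ℕ) (k l : Fin K) : ℕ := if l < k then s + 1 else s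

/-- A run of the iterative projected eigenvalue-ratio algorithm on the data `X`, with maximal number
of factors `rmax` and penalty constant `c`. Sweep `0` holds the initial loadings. Eigenvectors
and maximizers may be chosen arbitrarily where they are not unique. A `d k × d k` matrix has only
`d k` eigenvectors, whence the minima with `d k`. -/
structure IPERun {K T : ℕ} {d : Fin K → ℕ} (c : ℝ) (rmax : ℕ) (X : Fin T → Tensor d) where
  /-- the number of columns of the estimated loadings -/
  cols : ℕ → Fin K → ℕ
  /-- the estimated loadings `Â_k^{(s)}` -/
  loading : ∀ (s : ℕ) (k : Fin K), Matrix (Fin (d k)) (Fin (cols s k)) ℝ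
  /-- the estimated factor numbers `r̂_k^{(s)}`, `s ≥ 1` -/
  rhat : ℕ → Fin K → ℕ
  cols_zero : ∀ k, cols 0 k = min rmax (d k)
  loading_zero : ∀ k, IsLeadingEigenvectors (sampleCov X k) (loading 0 k)
  rhat_succ : ∀ s k, IsRatioArgmax
    (projCov X k (m := fun l => cols (sweepIndex s k l) l) fun l => loading (sweepIndex s k l) l)
    (c * (rateOmega T d k : ℝ) ^ (-(1 / 2) : ℝ)) rmax (rhat (s + 1) k)
  cols_succ : ∀ s k, cols (s + 1) k = min (rhat (s + 1) k + 2) (d k)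
  loading_succ : ∀ s k, IsLeadingEigenvectors
    (projCov X k (m := fun l => cols (sweepIndex s k l) l) fun l => loading (sweepIndex s k l) l)
    (loading (s + 1) k)

end TensorFactor

end

noncomputable section

namespace TensorFactor

/-! ### Spectral facts -/

/-! The argument splits into a deterministic part and one probabilistic estimate.

Deterministically, both the unprojected and the projected matrices are Gram matrices `(A H + N) (A H
+ N)ᵀ`, where `A` is the true loading of the mode, `H` the (projected) factors and `N` the
(projected) noise. If the signal has strength at least `σ₀` and the noise form is at most `η` with
`8 η ≤ σ₀`, then `λ_r ≥ σ₀/2 - η`, while `λ_{r+1} ≤ η` because the signal vanishes on the kernel of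
`Aᵀ`. Moreover any `m ≥ r` leading eigenvectors keep at least half of the squared length of every `A
z` (`le_capture`). Projecting the other modes onto such eigenvectors thus costs the signal at most a
factor `2^(K-1)`. This capture property is an invariant: it holds initially and is passed on by
every update (`IsGood.projected`, `IsGood.rhat_eq`), so a single noise event makes all sweeps
correct at once, which is why the stopping rule may depend on the data.

With penalty `δ`, the ratio is at least of order `1 / (η + δ)` at `r`, bounded below `r`, and at
most `η / δ` above `r`. So `r` wins once `η` and `δ` are small and `η²` is small against `δ`
(`IsRatioArgmax.eq`).

It remains to show that the projected noise form is at most a small multiple of `√δ`, uniformly over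
data-dependent projections. As the number of projection directions stays bounded, an operator norm
bound for the stacked unfolded errors suffices (`projected_noise_form_le`). Fourth moments give it:
the Frobenius norm of the centred Gram matrix is controlled by Markov's inequality
(`measure_form_gt_le`). The bounds `ω_k ≤ p_{-k}²` and `ω_k ≤ p_k T` make `δ` large enough to absorb
the mean and the fluctuation, whatever the relative rates (`tendsto_measure_projected_noise`). -/

lemma eigval_eq {q : ℕ} {M : Matrix (Fin q) (Fin q) ℝ} (hM : M.IsHermitian) (i : Fin q) :
    eigval M (i + 1) = hM.eigenvalues₀ ⟨i, by simp⟩ := by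
  have h : M.IsHermitian ∧ (i : ℕ) + 1 - 1 < Fintype.card (Fin q) := ⟨hM, by simp⟩
  rw [eigval, dif_pos h]
  rfl

lemma eigval_of_lt {q : ℕ} (M : Matrix (Fin q) (Fin q) ℝ) {j : ℕ} (h : q ≤ j) :
    eigval M (j + 1) = 0 := by
  simp [eigval, h]

/-- Spectral theorem with eigenvalues in decreasing order. -/
lemma exists_eigenbasis {q : ℕ} {M : Matrix (Fin q) (Fin q) ℝ} (hM : M.IsHermitian) :
    ∃ V : Matrix (Fin q) (Fin q) ℝ, Vᵀ * V = 1 ∧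
      ∀ j, M *ᵥ V.col j = eigval M (j + 1) • V.col j := by
  -- This is the equivalence through which `IsHermitian.eigenvalues` is defined; undoing it restores
  -- the decreasing order.
  let e : Fin (Fintype.card (Fin q)) ≃ Fin q := Fintype.equivOfCardEq (Fintype.card_fin _)
  let f : Fin q ≃ Fin q := (finCongr (Fintype.card_fin q).symm).trans e
  let b := hM.eigenvectorBasis
  refine ⟨Matrix.of fun i j => (b (f j)).ofLp i, ?_, fun j => ?_⟩
  · ext i j
    have h := b.inner_eq_ite (f i) (f j)
    simp only [f.injective.eq_iff] at h
    rw [Matrix.one_apply, ← h]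
    simp [Matrix.mul_apply, PiLp.inner_apply, mul_comm]
  · have h := hM.mulVec_eigenvectorBasis (f j)
    have h2 : hM.eigenvalues (f j) = eigval M (j + 1) := by
      rw [eigval_eq hM j, Matrix.IsHermitian.eigenvalues]
      congr 1
      simp [f, e]
      rfl
    rw [h2] at h
    exact h

lemma eigval_antitone_fin {q : ℕ} {M : Matrix (Fin q) (Fin q) ℝ} (hM : M.IsHermitian)
    {i j : Fin q} (hij : i ≤ j) : eigval M (j + 1) ≤ eigval M (i + 1) := by
  rw [eigval_eq hM, eigval_eq hM]
  exact hM.eigenvalues₀_antitone hij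

lemma mulVec_mulVec_of_eigen {q m : ℕ} {M : Matrix (Fin q) (Fin q) ℝ}
    {U : Matrix (Fin q) (Fin m) ℝ} {l : Fin m → ℝ}
    (hl : ∀ j, M *ᵥ U.col j = l j • U.col j) (a : Fin m → ℝ) :
    M *ᵥ (U *ᵥ a) = U *ᵥ (fun j => l j * a j) := by
  have h : M * U = U * Matrix.diagonal l := by
    ext i j
    have := congrFun (hl j) i
    rw [Matrix.mul_diagonal, Matrix.mul_apply]
    simpa [Matrix.mulVec, dotProduct, mul_comm] using this
  rw [Matrix.mulVec_mulVec, h, ← Matrix.mulVec_mulVec]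
  congr 1
  ext j
  simp [Matrix.mulVec_diagonal]

lemma dotProduct_mulVec_self {α β : Type*} [Fintype α] [Fintype β]
    (U : Matrix α β ℝ) (x : α → ℝ) (a : β → ℝ) : x ⬝ᵥ (U *ᵥ a) = (Uᵀ *ᵥ x) ⬝ᵥ a := by
  rw [Matrix.dotProduct_mulVec, Matrix.mulVec_transpose]

lemma orthonormal_dotProduct {α β : Type*} [Fintype α] [Fintype β] [DecidableEq β]
    {U : Matrix α β ℝ} (hU : Uᵀ * U = 1) (a b : β → ℝ) : (U *ᵥ a) ⬝ᵥ (U *ᵥ b) = a ⬝ᵥ b := by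
  rw [dotProduct_mulVec_self, Matrix.mulVec_mulVec, hU, Matrix.one_mulVec]

lemma dotProduct_self_pos {α : Type*} [Fintype α] {x : α → ℝ} (hx : x ≠ 0) : 0 < x ⬝ᵥ x := by
  simpa using Matrix.dotProduct_star_self_pos_iff.2 hx

lemma dotProduct_self_nonneg {α : Type*} [Fintype α] (x : α → ℝ) : 0 ≤ x ⬝ᵥ x :=
  Finset.sum_nonneg fun i _ => mul_self_nonneg (x i)

lemma exists_ne_zero_map_eq_zero {α β : Type*} [Fintype α] [Fintype β]
    (h : Fintype.card β < Fintype.card α) (f : (α → ℝ) →ₗ[ℝ] (β → ℝ)) :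
    ∃ a : α → ℝ, a ≠ 0 ∧ f a = 0 := by
  have := LinearMap.ker_ne_bot_of_finrank_lt (f := f) (by simpa using h)
  obtain ⟨a, ha, ha0⟩ := (Submodule.ne_bot_iff _).1 this
  exact ⟨a, ha0, ha⟩

/-- Courant–Fischer, lower bound for the `r`-th eigenvalue. -/
lemma le_eigval {q r : ℕ} {M : Matrix (Fin q) (Fin q) ℝ} (hM : M.IsHermitian) (hr : 1 ≤ r)
    (hrq : r ≤ q) {A : Matrix (Fin q) (Fin r) ℝ} (hA : Function.Injective A.mulVec) {κ : ℝ}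
    (h : ∀ z, κ * ((A *ᵥ z) ⬝ᵥ (A *ᵥ z)) ≤ (A *ᵥ z) ⬝ᵥ (M *ᵥ (A *ᵥ z))) :
    κ ≤ eigval M r := by
  obtain ⟨V, hV, hVM⟩ := exists_eigenbasis hM
  have hV' : V * Vᵀ = 1 := mul_eq_one_comm.1 hV
  -- Orthogonality of `A z` to the first `r - 1` eigenvectors is `r - 1` equations in `r` unknowns;
  -- on a solution the form is at most `λ_r`.
  let f : (Fin r → ℝ) →ₗ[ℝ] (Fin (r - 1) → ℝ) :=
    (LinearMap.funLeft ℝ ℝ (fun i : Fin (r - 1) => (⟨i, by omega⟩ : Fin q))) ∘ₗ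
      (Vᵀ * A).mulVecLin
  obtain ⟨z, hz, hfz⟩ := exists_ne_zero_map_eq_zero (by simp; omega) f
  set y := Vᵀ *ᵥ (A *ᵥ z) with hy
  have hyz : ∀ i : Fin q, (i : ℕ) < r - 1 → y i = 0 := by
    intro i hi
    have := congrFun hfz ⟨i, hi⟩
    rw [hy, Matrix.mulVec_mulVec]
    exact this
  have hx : A *ᵥ z = V *ᵥ y := by rw [hy, Matrix.mulVec_mulVec, hV', Matrix.one_mulVec]
  have hx0 : A *ᵥ z ≠ 0 := fun h0 => hz (hA (by simpa using h0))
  have hp := dotProduct_self_pos hx0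
  have h1 := h z
  have h2 : (A *ᵥ z) ⬝ᵥ (M *ᵥ (A *ᵥ z)) ≤ eigval M r * ((A *ᵥ z) ⬝ᵥ (A *ᵥ z)) := by
    rw [hx, mulVec_mulVec_of_eigen hVM, orthonormal_dotProduct hV,
      orthonormal_dotProduct hV, dotProduct, dotProduct, Finset.mul_sum]
    refine Finset.sum_le_sum fun i _ => ?_
    by_cases hi : (i : ℕ) < r - 1
    · simp [hyz i hi]
    · have := eigval_antitone_fin hM (i := ⟨r - 1, by omega⟩) (j := i)
        (by rw [Fin.le_def]; simp; omega)
      simp only [Nat.sub_add_cancel hr] at this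
      nlinarith [mul_self_nonneg (y i)]
  exact le_of_mul_le_mul_right (h1.trans h2) hp

/-- Courant–Fischer, upper bound for the `r + 1`-st eigenvalue. -/
lemma eigval_succ_le {q r : ℕ} {M : Matrix (Fin q) (Fin q) ℝ} (hM : M.IsHermitian)
    (A : Matrix (Fin q) (Fin r) ℝ) {η : ℝ} (hη : 0 ≤ η)
    (h : ∀ x, Aᵀ *ᵥ x = 0 → x ⬝ᵥ (M *ᵥ x) ≤ η * (x ⬝ᵥ x)) :
    eigval M (r + 1) ≤ η := by
  by_cases hrq : q ≤ r
  · rw [eigval_of_lt M hrq]; exact hη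
  push Not at hrq
  obtain ⟨V, hV, hVM⟩ := exists_eigenbasis hM
  -- The `r` equations of `Aᵀ x = 0` and `q - r - 1` equations that put `x` in the span of the first
  -- `r + 1` eigenvectors leave a nonzero solution.
  let f : (Fin q → ℝ) →ₗ[ℝ] (Fin r ⊕ Fin (q - r - 1) → ℝ) :=
    LinearMap.pi (Sum.elim (fun i => LinearMap.proj i ∘ₗ (Aᵀ * V).mulVecLin)
      (fun i => LinearMap.proj (⟨r + 1 + i, by omega⟩ : Fin q)))
  obtain ⟨y, hy, hfy⟩ := exists_ne_zero_map_eq_zero (by simp; omega) f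
  have hA : Aᵀ *ᵥ (V *ᵥ y) = 0 := by
    ext i
    have := congrFun hfy (Sum.inl i)
    rw [Matrix.mulVec_mulVec]
    exact this
  have hy0 : ∀ i : Fin q, r + 1 ≤ (i : ℕ) → y i = 0 := by
    intro i hi
    have := congrFun hfy (Sum.inr ⟨i - (r + 1), by omega⟩)
    simp only [f, LinearMap.pi_apply, Sum.elim_inr, LinearMap.proj_apply, Pi.zero_apply] at this
    convert this using 2
    ext; simp; omega
  have h1 := h _ hA
  rw [mulVec_mulVec_of_eigen hVM, orthonormal_dotProduct hV,
      orthonormal_dotProduct hV] at h1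
  refine le_of_mul_le_mul_right (le_trans ?_ h1) (dotProduct_self_pos hy)
  rw [dotProduct, dotProduct, Finset.mul_sum]
  refine Finset.sum_le_sum fun i _ => ?_
  by_cases hi : r + 1 ≤ (i : ℕ)
  · simp [hy0 i hi]
  · have := eigval_antitone_fin hM (i := i) (j := ⟨r, hrq⟩)
      (by rw [Fin.le_def]; simp; omega)
    simp only at this
    nlinarith [mul_self_nonneg (y i)]

lemma eigval_le_of_form_le {q : ℕ} {M : Matrix (Fin q) (Fin q) ℝ} (hM : M.IsHermitian) {C : ℝ}
    (hC : 0 ≤ C) (h : ∀ x, x ⬝ᵥ (M *ᵥ x) ≤ C * (x ⬝ᵥ x)) (j : ℕ) : eigval M (j + 1) ≤ C := by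
  by_cases hj : q ≤ j
  · rw [eigval_of_lt M hj]; exact hC
  push Not at hj
  have h1 := eigval_succ_le (r := 0) hM 0 hC (fun x _ => h x)
  exact (eigval_antitone_fin hM (i := ⟨0, by omega⟩) (j := ⟨j, hj⟩) (Fin.mk_le_mk.2 (by omega))).trans
    (by simpa using h1)

lemma eigval_nonneg {q : ℕ} {M : Matrix (Fin q) (Fin q) ℝ} (hM : M.IsHermitian)
    (h : ∀ x, 0 ≤ x ⬝ᵥ (M *ᵥ x)) (j : ℕ) : 0 ≤ eigval M (j + 1) := by
  by_cases hj : q ≤ j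
  · rw [eigval_of_lt M hj]
  push Not at hj
  obtain ⟨V, hV, hVM⟩ := exists_eigenbasis hM
  have h1 := h (V.col ⟨j, hj⟩)
  rw [hVM] at h1
  have h2 : V.col ⟨j, hj⟩ ⬝ᵥ V.col ⟨j, hj⟩ = 1 := by
    have := congrFun (congrFun hV ⟨j, hj⟩) ⟨j, hj⟩
    simpa [Matrix.mul_apply, dotProduct] using this
  simpa [h2] using h1

lemma eigval_antitone {q : ℕ} {M : Matrix (Fin q) (Fin q) ℝ} (hM : M.IsHermitian)
    (h : ∀ x, 0 ≤ x ⬝ᵥ (M *ᵥ x)) {i j : ℕ} (hi : 1 ≤ i) (hij : i ≤ j) :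
    eigval M j ≤ eigval M i := by
  obtain ⟨i, rfl⟩ := Nat.exists_eq_add_of_le' hi
  obtain ⟨j, rfl⟩ := Nat.exists_eq_add_of_le' (hi.trans hij)
  by_cases hj : q ≤ j
  · rw [eigval_of_lt M hj]; exact eigval_nonneg hM h i
  · exact eigval_antitone_fin hM (i := ⟨i, by omega⟩) (j := ⟨j, by omega⟩)
      (Fin.mk_le_mk.2 (by omega))

/-- The form of `M` is small orthogonally to sufficiently many leading eigenvectors. -/
lemma form_le_of_orthogonal {q r m : ℕ} {M : Matrix (Fin q) (Fin q) ℝ} (hM : M.IsHermitian)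
    (hM0 : ∀ x, 0 ≤ x ⬝ᵥ (M *ᵥ x))
    (A : Matrix (Fin q) (Fin r) ℝ) {η : ℝ}
    (h : ∀ x, Aᵀ *ᵥ x = 0 → x ⬝ᵥ (M *ᵥ x) ≤ η * (x ⬝ᵥ x)) (hlt : η < eigval M r)
    {U : Matrix (Fin q) (Fin m) ℝ} (hU : Uᵀ * U = 1)
    (hUM : ∀ j : Fin m, M *ᵥ U.col j = eigval M (j + 1) • U.col j) (hrm : r ≤ m)
    {w : Fin q → ℝ} (hw : Uᵀ *ᵥ w = 0) : w ⬝ᵥ (M *ᵥ w) ≤ η * (w ⬝ᵥ w) := by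
  by_contra! hcon
  -- The first `r` eigenvectors and `w` span `r + 1` dimensions, so some nonzero combination lies in
  -- the kernel of `Aᵀ`. If the form at `w` exceeded `η`, it would exceed `η` on the whole span, as
  -- the cross terms vanish.
  let f : (Fin m ⊕ Unit → ℝ) →ₗ[ℝ] (Fin r ⊕ Fin (m - r) → ℝ) :=
    LinearMap.pi (Sum.elim
      (fun i => LinearMap.proj i ∘ₗ ((Aᵀ * U).mulVecLin ∘ₗ LinearMap.funLeft ℝ ℝ Sum.inl +
        (LinearMap.proj (Sum.inr ())).smulRight (Aᵀ *ᵥ w)))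
      (fun i => LinearMap.proj (Sum.inl (⟨r + i, by omega⟩ : Fin m))))
  obtain ⟨y, hy, hfy⟩ := exists_ne_zero_map_eq_zero (by simp; omega) f
  set a : Fin m → ℝ := fun i => y (Sum.inl i) with ha
  set b : ℝ := y (Sum.inr ()) with hb
  have hA : Aᵀ *ᵥ (U *ᵥ a + b • w) = 0 := by
    ext i
    have := congrFun hfy (Sum.inl i)
    simp only [f, LinearMap.pi_apply, Sum.elim_inl, LinearMap.comp_apply, LinearMap.add_apply,
      LinearMap.proj_apply, Pi.zero_apply, LinearMap.smulRight_apply, Matrix.mulVecLin_apply] at this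
    rw [Matrix.mulVec_add, Matrix.mulVec_mulVec, Matrix.mulVec_smul]
    exact this
  have ha0 : ∀ i : Fin m, r ≤ (i : ℕ) → a i = 0 := by
    intro i hi
    have := congrFun hfy (Sum.inr ⟨i - r, by omega⟩)
    simp only [f, LinearMap.pi_apply, Sum.elim_inr, LinearMap.proj_apply, Pi.zero_apply] at this
    rw [← this, ha]
    congr 2
    ext; simp; omega
  have h1 := h _ hA
  have hMs : Mᵀ = M := by simpa [Matrix.IsHermitian] using hM
  have hUw : ∀ c : Fin m → ℝ, w ⬝ᵥ (U *ᵥ c) = 0 := fun c => by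
    rw [dotProduct_mulVec_self, hw, zero_dotProduct]
  have hcr : (U *ᵥ a) ⬝ᵥ (M *ᵥ w) = 0 := by
    rw [dotProduct_mulVec_self, hMs, mulVec_mulVec_of_eigen hUM, dotProduct_comm, hUw]
  have e1 : (U *ᵥ a + b • w) ⬝ᵥ (M *ᵥ (U *ᵥ a + b • w)) =
      ∑ j : Fin m, eigval M (j + 1) * (a j * a j) + b * b * (w ⬝ᵥ (M *ᵥ w)) := by
    rw [Matrix.mulVec_add, Matrix.mulVec_smul, add_dotProduct, dotProduct_add, dotProduct_add,
      mulVec_mulVec_of_eigen hUM, orthonormal_dotProduct hU]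
    simp only [smul_dotProduct, dotProduct_smul, hUw, hcr, smul_eq_mul]
    rw [dotProduct]
    simp only [mul_zero, add_zero, zero_add, mul_assoc]
    congr 1
    exact Finset.sum_congr rfl fun i _ => by ring
  have e2 : (U *ᵥ a + b • w) ⬝ᵥ (U *ᵥ a + b • w) = ∑ j, a j * a j + b * b * (w ⬝ᵥ w) := by
    rw [add_dotProduct, dotProduct_add, dotProduct_add, orthonormal_dotProduct hU]
    simp only [smul_dotProduct, dotProduct_smul, hUw, smul_eq_mul, dotProduct_comm (U *ᵥ a) w]
    rw [dotProduct]
    ring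
  rw [e1, e2, mul_add, Finset.mul_sum] at h1
  have hterm : ∀ j : Fin m, η * (a j * a j) ≤ eigval M (j + 1) * (a j * a j) ∧
      (a j ≠ 0 → η * (a j * a j) < eigval M (j + 1) * (a j * a j)) := by
    intro j
    by_cases hj : r ≤ (j : ℕ)
    · simp [ha0 j hj]
    · have : η < eigval M (j + 1) := hlt.trans_le (eigval_antitone hM hM0 (by omega) (by omega))
      exact ⟨by nlinarith [mul_self_nonneg (a j)],
        fun h0 => mul_lt_mul_of_pos_right this (mul_self_pos.2 h0)⟩
  have hsum : ∑ j, η * (a j * a j) ≤ ∑ j : Fin m, eigval M (j + 1) * (a j * a j) :=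
    Finset.sum_le_sum fun j _ => (hterm j).1
  by_cases hb0 : b = 0
  · obtain ⟨j, hj⟩ : ∃ j, a j ≠ 0 := by
      by_contra! hc
      apply hy
      ext i
      rcases i with i | i
      · exact hc i
      · exact hb0
    have := Finset.sum_lt_sum (s := Finset.univ) (fun j _ => (hterm j).1)
      ⟨j, Finset.mem_univ _, (hterm j).2 hj⟩
    simp only [hb0] at h1
    linarith
  · nlinarith [mul_self_pos.2 hb0]

/-! ### Kronecker products over a finite family -/

open scoped MatrixOrder in
lemma exists_eq_transpose_mul_self {n : Type*} [Fintype n] {M : Matrix n n ℝ}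
    (hM : M.PosSemidef) : ∃ B : Matrix n n ℝ, M = Bᵀ * B := by
  classical
  obtain ⟨B, hB⟩ := CStarAlgebra.nonneg_iff_eq_star_mul_self.mp hM.nonneg
  exact ⟨B, by simpa [Matrix.star_eq_conjTranspose] using hB⟩

lemma posSemidef_of_form {n : Type*} [Fintype n] {M : Matrix n n ℝ} (hM : M.IsHermitian)
    (h : ∀ x, 0 ≤ x ⬝ᵥ (M *ᵥ x)) : M.PosSemidef :=
  Matrix.PosSemidef.of_dotProduct_mulVec_nonneg hM (by simpa using h)

lemma form_nonneg {n : Type*} [Fintype n] {M : Matrix n n ℝ} (hM : M.PosSemidef) (x : n → ℝ) :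
    0 ≤ x ⬝ᵥ (M *ᵥ x) := by
  simpa using hM.dotProduct_mulVec_nonneg x

lemma dotProduct_mulVec_mulVec {α β : Type*} [Fintype α] [Fintype β] (C : Matrix α β ℝ)
    (x : β → ℝ) : (C *ᵥ x) ⬝ᵥ (C *ᵥ x) = x ⬝ᵥ ((Cᵀ * C) *ᵥ x) := by
  rw [dotProduct_mulVec_self, Matrix.mulVec_mulVec, dotProduct_comm]

section Kron

variable {ι : Type} [Fintype ι]

/-- The Kronecker product of a finite family of matrices. -/
def kron {κ μ : ι → Type} (W : ∀ l, Matrix (μ l) (κ l) ℝ) :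
    Matrix (∀ l, μ l) (∀ l, κ l) ℝ :=
  Matrix.of fun i j => ∏ l, W l (i l) (j l)

lemma kron_mul [DecidableEq ι] {κ μ ξ : ι → Type} [∀ l, Fintype (κ l)]
    (X : ∀ l, Matrix (μ l) (κ l) ℝ) (Y : ∀ l, Matrix (κ l) (ξ l) ℝ) :
    kron X * kron Y = kron fun l => X l * Y l := by
  ext i j
  simp only [kron, Matrix.mul_apply, Matrix.of_apply, ← Finset.prod_mul_distrib]
  rw [Finset.prod_univ_sum, Fintype.piFinset_univ]

lemma kron_transpose {κ μ : ι → Type} (W : ∀ l, Matrix (μ l) (κ l) ℝ) :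
    (kron W)ᵀ = kron fun l => (W l)ᵀ := rfl

lemma kron_smul {κ μ : ι → Type} (a : ι → ℝ) (W : ∀ l, Matrix (μ l) (κ l) ℝ) :
    kron (fun l => a l • W l) = (∏ l, a l) • kron W := by
  ext i j
  simp [kron, Finset.prod_mul_distrib]

lemma kron_one {κ : ι → Type} [∀ l, DecidableEq (κ l)] : kron (fun l => (1 : Matrix (κ l) (κ l) ℝ)) = 1 := by
  ext i j
  simp only [kron, Matrix.of_apply, Matrix.one_apply]
  by_cases h : i = j
  · simp [h]
  · obtain ⟨l, hl⟩ := Function.ne_iff.1 h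
    rw [if_neg h]
    exact Finset.prod_eq_zero (Finset.mem_univ l) (if_neg hl)

variable [DecidableEq ι] {κ μ : ι → Type} [∀ l, Fintype (κ l)] [∀ l, Fintype (μ l)]

lemma kron_posSemidef {D : ∀ l, Matrix (κ l) (κ l) ℝ} (hD : ∀ l, (D l).PosSemidef) :
    (kron D).PosSemidef := by
  choose B hB using fun l => exists_eq_transpose_mul_self (hD l)
  have h : kron D = (kron B)ᵀ * kron B := by
    rw [kron_transpose, kron_mul]
    exact congrArg kron (funext hB)
  rw [h]
  simpa using Matrix.posSemidef_conjTranspose_mul_self (kron B)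

/-- The Kronecker product is monotone in the Loewner order. -/
lemma kron_add_sub_posSemidef {D R : ∀ l, Matrix (κ l) (κ l) ℝ} (hD : ∀ l, (D l).PosSemidef)
    (hR : ∀ l, (R l).PosSemidef) : (kron (fun l => D l + R l) - kron D).PosSemidef := by
  -- Multilinear expansion over subsets: every term is positive semidefinite, and `S = univ` is
  -- `kron D`.
  have h : kron (fun l => D l + R l) =
      ∑ S : Finset ι, kron (fun l => if l ∈ S then D l else R l) := by
    ext i j
    rw [Matrix.sum_apply]
    simp only [kron, Matrix.of_apply, Matrix.add_apply]
    rw [Finset.prod_add, Finset.powerset_univ]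
    refine Finset.sum_congr rfl fun S _ => ?_
    rw [← Finset.prod_mul_prod_compl S (fun l => (if l ∈ S then D l else R l) (i l) (j l)),
      Finset.compl_eq_univ_sdiff]
    congr 1
    · exact Finset.prod_congr rfl fun l hl => by rw [if_pos hl]
    · exact Finset.prod_congr rfl fun l hl => by rw [if_neg (Finset.mem_sdiff.1 hl).2]
  have h2 : kron D = kron (fun l => if l ∈ (Finset.univ : Finset ι) then D l else R l) := by
    simp
  rw [h, ← Finset.add_sum_erase _ _ (Finset.mem_univ Finset.univ), ← h2, add_sub_cancel_left]
  refine Matrix.posSemidef_sum _ fun S _ => kron_posSemidef fun l => ?_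
  split_ifs
  · exact hD l
  · exact hR l

/-- Loewner monotonicity for the splitting `Cᵀ C = a • 1 + (Cᵀ C - a • 1)` in each factor; the upper
bound below splits `b • 1` around `Cᵀ C` instead. -/
lemma le_kron_form {C : ∀ l, Matrix (μ l) (κ l) ℝ} {a : ι → ℝ} (ha : ∀ l, 0 ≤ a l)
    (h : ∀ l z, a l * (z ⬝ᵥ z) ≤ (C l *ᵥ z) ⬝ᵥ (C l *ᵥ z)) (x : (∀ l, κ l) → ℝ) :
    (∏ l, a l) * (x ⬝ᵥ x) ≤ (kron C *ᵥ x) ⬝ᵥ (kron C *ᵥ x) := by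
  classical
  have hR : ∀ l, ((C l)ᵀ * C l - a l • 1).PosSemidef := fun l => by
    refine posSemidef_of_form ?_ fun z => ?_
    · simp [Matrix.IsHermitian, Matrix.transpose_mul]
    · have := h l z
      rw [dotProduct_mulVec_mulVec] at this
      simpa [Matrix.sub_mulVec, Matrix.smul_mulVec] using this
  have hD : ∀ l, (a l • (1 : Matrix (κ l) (κ l) ℝ)).PosSemidef :=
    fun l => Matrix.PosSemidef.one.smul (ha l)
  have := form_nonneg (kron_add_sub_posSemidef hD hR) x
  simp only [add_sub_cancel] at this
  rw [kron_smul, kron_one, ← kron_mul, ← kron_transpose, Matrix.sub_mulVec, dotProduct_sub,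
    ← dotProduct_mulVec_mulVec] at this
  simpa [Matrix.smul_mulVec] using this

lemma kron_form_le {C : ∀ l, Matrix (μ l) (κ l) ℝ} {b : ι → ℝ}
    (h : ∀ l z, (C l *ᵥ z) ⬝ᵥ (C l *ᵥ z) ≤ b l * (z ⬝ᵥ z)) (x : (∀ l, κ l) → ℝ) :
    (kron C *ᵥ x) ⬝ᵥ (kron C *ᵥ x) ≤ (∏ l, b l) * (x ⬝ᵥ x) := by
  classical
  have hR : ∀ l, (b l • 1 - (C l)ᵀ * C l).PosSemidef := fun l => by
    refine posSemidef_of_form ?_ fun z => ?_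
    · simp [Matrix.IsHermitian, Matrix.transpose_mul]
    · have := h l z
      rw [dotProduct_mulVec_mulVec] at this
      simpa [Matrix.sub_mulVec, Matrix.smul_mulVec] using this
  have hD : ∀ l, ((C l)ᵀ * C l).PosSemidef := fun l => by
    simpa using Matrix.posSemidef_conjTranspose_mul_self (C l)
  have := form_nonneg (kron_add_sub_posSemidef hD hR) x
  simp only [add_sub_cancel] at this
  rw [kron_smul, kron_one, ← kron_mul, ← kron_transpose, Matrix.sub_mulVec, dotProduct_sub,
    ← dotProduct_mulVec_mulVec] at this
  simpa [Matrix.smul_mulVec] using this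

end Kron

/-! ### Perturbation of a factor structure -/

lemma sum_add_sq_le {τ : Type*} [Fintype τ] (u v : τ → ℝ) :
    (u + v) ⬝ᵥ (u + v) ≤ 2 * (u ⬝ᵥ u) + 2 * (v ⬝ᵥ v) := by
  simp only [dotProduct, Finset.mul_sum, ← Finset.sum_add_distrib, Pi.add_apply]
  exact Finset.sum_le_sum fun i _ => by nlinarith [mul_self_nonneg (u i - v i)]

lemma half_le_sum_add_sq {τ : Type*} [Fintype τ] (u v : τ → ℝ) :
    (u ⬝ᵥ u) / 2 - v ⬝ᵥ v ≤ (u + v) ⬝ᵥ (u + v) := by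
  have := sum_add_sq_le (u + v) (-v)
  simp only [add_neg_cancel_right, neg_dotProduct_neg] at this
  linarith

section Perturbation

variable {q r : ℕ} {τ : Type} [Fintype τ] {A : Matrix (Fin q) (Fin r) ℝ}
  {H : Matrix (Fin r) τ ℝ} {N : Matrix (Fin q) τ ℝ} {σ₀ C₀ η : ℝ}

/-- The Gram matrix of a factor structure with noise. -/
def noisyGram (A : Matrix (Fin q) (Fin r) ℝ) (H : Matrix (Fin r) τ ℝ) (N : Matrix (Fin q) τ ℝ) :
    Matrix (Fin q) (Fin q) ℝ := (A * H + N) * (A * H + N)ᵀ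

lemma noisyGram_isHermitian : (noisyGram A H N).IsHermitian := by
  simp [Matrix.IsHermitian, noisyGram, Matrix.transpose_mul]

lemma noisyGram_form (x : Fin q → ℝ) : x ⬝ᵥ (noisyGram A H N *ᵥ x) =
    (Hᵀ *ᵥ (Aᵀ *ᵥ x) + Nᵀ *ᵥ x) ⬝ᵥ (Hᵀ *ᵥ (Aᵀ *ᵥ x) + Nᵀ *ᵥ x) := by
  have h := dotProduct_mulVec_mulVec (A * H + N)ᵀ x
  rw [Matrix.transpose_transpose] at h
  rw [noisyGram, ← h, Matrix.transpose_add, Matrix.add_mulVec, Matrix.transpose_mul,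
    Matrix.mulVec_mulVec]

lemma noisyGram_form_nonneg (x : Fin q → ℝ) : 0 ≤ x ⬝ᵥ (noisyGram A H N *ᵥ x) := by
  rw [noisyGram_form]
  exact dotProduct_self_nonneg _

lemma transpose_mulVec_smul_one (hA : Aᵀ * A = (q : ℝ) • 1) (z : Fin r → ℝ) :
    Aᵀ *ᵥ (A *ᵥ z) = (q : ℝ) • z := by
  rw [Matrix.mulVec_mulVec, hA, Matrix.smul_mulVec, Matrix.one_mulVec]

lemma loading_form (hA : Aᵀ * A = (q : ℝ) • 1) (z : Fin r → ℝ) :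
    (A *ᵥ z) ⬝ᵥ (A *ᵥ z) = q * (z ⬝ᵥ z) := by
  rw [dotProduct_mulVec_self, transpose_mulVec_smul_one hA, smul_dotProduct, smul_eq_mul]

lemma transpose_loading_form_le (hq : 0 < q) (hA : Aᵀ * A = (q : ℝ) • 1) (x : Fin q → ℝ) :
    (Aᵀ *ᵥ x) ⬝ᵥ (Aᵀ *ᵥ x) ≤ q * (x ⬝ᵥ x) := by
  have hq' : (0 : ℝ) < q := by exact_mod_cast hq
  have h := dotProduct_self_nonneg (x - (q : ℝ)⁻¹ • (A *ᵥ (Aᵀ *ᵥ x)))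
  have h1 : x ⬝ᵥ (A *ᵥ (Aᵀ *ᵥ x)) = (Aᵀ *ᵥ x) ⬝ᵥ (Aᵀ *ᵥ x) := dotProduct_mulVec_self _ _ _
  simp only [sub_dotProduct, dotProduct_sub, smul_dotProduct, dotProduct_smul, smul_eq_mul,
    loading_form hA, h1, dotProduct_comm (A *ᵥ (Aᵀ *ᵥ x)) x] at h
  field_simp at h
  nlinarith

/-- No signal–noise cross term survives on the kernel of `Aᵀ`, so the bound is `η` itself and not of
order `√η`. -/
lemma noisyGram_form_le (hN : ∀ x, (Nᵀ *ᵥ x) ⬝ᵥ (Nᵀ *ᵥ x) ≤ η * (x ⬝ᵥ x)) (x : Fin q → ℝ)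
    (hx : Aᵀ *ᵥ x = 0) : x ⬝ᵥ (noisyGram A H N *ᵥ x) ≤ η * (x ⬝ᵥ x) := by
  rw [noisyGram_form, hx, Matrix.mulVec_zero, zero_add]
  exact hN x

/-- Courant–Fischer on the column span of `A`; the factor 1/2 is the price of separating signal and
noise. -/
lemma le_eigval_noisyGram (hr : 1 ≤ r) (hrq : r ≤ q) (hA : Aᵀ * A = (q : ℝ) • 1)
    (hH : ∀ z, σ₀ * (z ⬝ᵥ z) ≤ q * ((Hᵀ *ᵥ z) ⬝ᵥ (Hᵀ *ᵥ z)))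
    (hN : ∀ x, (Nᵀ *ᵥ x) ⬝ᵥ (Nᵀ *ᵥ x) ≤ η * (x ⬝ᵥ x)) :
    σ₀ / 2 - η ≤ eigval (noisyGram A H N) r := by
  have hq' : (0 : ℝ) < q := by exact_mod_cast (by omega : 0 < q)
  refine le_eigval (A := A) noisyGram_isHermitian hr hrq ?_ fun z => ?_
  · intro z w hzw
    have := congrArg (fun v => Aᵀ *ᵥ v) hzw
    simp only [transpose_mulVec_smul_one hA] at this
    exact smul_right_injective _ hq'.ne' this
  · rw [noisyGram_form]
    refine le_trans ?_ (half_le_sum_add_sq _ _)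
    have h1 := hN (A *ᵥ z)
    have h2 := hH z
    rw [transpose_mulVec_smul_one hA, Matrix.mulVec_smul, smul_dotProduct, dotProduct_smul]
    rw [loading_form hA] at h1 ⊢
    simp only [smul_eq_mul]
    nlinarith

lemma eigval_noisyGram_le (hη : 0 ≤ η) (hN : ∀ x, (Nᵀ *ᵥ x) ⬝ᵥ (Nᵀ *ᵥ x) ≤ η * (x ⬝ᵥ x)) :
    eigval (noisyGram A H N) (r + 1) ≤ η :=
  eigval_succ_le noisyGram_isHermitian A hη (noisyGram_form_le hN)

lemma eigval_noisyGram_le_const (hq : 0 < q) (hA : Aᵀ * A = (q : ℝ) • 1) (hη : 0 ≤ η)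
    (hC₀ : 0 ≤ C₀) (hH : ∀ z, q * ((Hᵀ *ᵥ z) ⬝ᵥ (Hᵀ *ᵥ z)) ≤ C₀ * (z ⬝ᵥ z))
    (hN : ∀ x, (Nᵀ *ᵥ x) ⬝ᵥ (Nᵀ *ᵥ x) ≤ η * (x ⬝ᵥ x)) (j : ℕ) :
    eigval (noisyGram A H N) (j + 1) ≤ 2 * C₀ + 2 * η := by
  refine eigval_le_of_form_le noisyGram_isHermitian (by positivity) (fun x => ?_) j
  rw [noisyGram_form]
  refine (sum_add_sq_le _ _).trans ?_
  have hq' : (0 : ℝ) < q := by exact_mod_cast hq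
  have h1 := hH (Aᵀ *ᵥ x)
  have h2 := mul_le_mul_of_nonneg_left (transpose_loading_form_le hq hA x) hC₀
  have h3 : (Hᵀ *ᵥ Aᵀ *ᵥ x) ⬝ᵥ (Hᵀ *ᵥ Aᵀ *ᵥ x) ≤ C₀ * (x ⬝ᵥ x) := by
    refine le_of_mul_le_mul_left ?_ hq'
    linarith
  nlinarith [hN x]

/-- Sufficiently many leading eigenvectors of `noisyGram` capture the loadings. -/
lemma le_capture (hr : 1 ≤ r) (hrq : r ≤ q) (hA : Aᵀ * A = (q : ℝ) • 1) (hσ : 0 < σ₀)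
    (hH : ∀ z, σ₀ * (z ⬝ᵥ z) ≤ q * ((Hᵀ *ᵥ z) ⬝ᵥ (Hᵀ *ᵥ z)))
    (hησ : 8 * η ≤ σ₀)
    (hN : ∀ x, (Nᵀ *ᵥ x) ⬝ᵥ (Nᵀ *ᵥ x) ≤ η * (x ⬝ᵥ x)) {m : ℕ} (hrm : r ≤ m)
    {U : Matrix (Fin q) (Fin m) ℝ} (hU : Uᵀ * U = 1)
    (hUM : ∀ j : Fin m, noisyGram A H N *ᵥ U.col j =
      eigval (noisyGram A H N) (j + 1) • U.col j) (z : Fin r → ℝ) :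
    (q : ℝ) / 2 * (z ⬝ᵥ z) ≤ ((Uᵀ * A) *ᵥ z) ⬝ᵥ ((Uᵀ * A) *ᵥ z) := by
  have hq' : (0 : ℝ) < q := by exact_mod_cast (by omega : 0 < q)
  set x := A *ᵥ z with hx
  -- The residual of `x = A z` off the eigenvectors. The form is at most `η` there, so the signal
  -- forces `Aᵀ w` to be small; since `w ⬝ᵥ w = (Aᵀ w) ⬝ᵥ z`, the residual is small too.
  set w := x - U *ᵥ (Uᵀ *ᵥ x) with hw
  have hUw : Uᵀ *ᵥ w = 0 := by
    rw [hw, Matrix.mulVec_sub, Matrix.mulVec_mulVec _ Uᵀ U, hU, Matrix.one_mulVec, sub_self]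
  have hlt : η < eigval (noisyGram A H N) r :=
    lt_of_lt_of_le (by linarith) (le_eigval_noisyGram hr hrq hA hH hN)
  have h1 := form_le_of_orthogonal noisyGram_isHermitian noisyGram_form_nonneg A
    (noisyGram_form_le hN) hlt hU hUM hrm hUw
  rw [noisyGram_form] at h1
  have h2 := half_le_sum_add_sq (Hᵀ *ᵥ Aᵀ *ᵥ w) (Nᵀ *ᵥ w)
  have h3 := hN w
  have h4 := hH (Aᵀ *ᵥ w)
  have h5 : σ₀ * ((Aᵀ *ᵥ w) ⬝ᵥ (Aᵀ *ᵥ w)) ≤ q * (4 * η * (w ⬝ᵥ w)) :=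
    h4.trans (mul_le_mul_of_nonneg_left (by linarith) hq'.le)
  have hwx : w ⬝ᵥ w = w ⬝ᵥ x := by
    conv_lhs => rw [hw]
    rw [← hw, dotProduct_sub, dotProduct_mulVec_self U, hUw, zero_dotProduct, sub_zero]
  have hxx : x ⬝ᵥ x = q * (z ⬝ᵥ z) := loading_form hA z
  have hwz : w ⬝ᵥ w = (Aᵀ *ᵥ w) ⬝ᵥ z := by rw [hwx, hx, dotProduct_mulVec_self]
  have hnorm : ((Uᵀ * A) *ᵥ z) ⬝ᵥ ((Uᵀ * A) *ᵥ z) = x ⬝ᵥ x - w ⬝ᵥ w := by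
    rw [← Matrix.mulVec_mulVec, ← hx, hwx, hw, sub_dotProduct, dotProduct_comm (U *ᵥ _) x,
      dotProduct_mulVec_self U]
    ring
  rw [hnorm, hxx]
  -- Young's inequality, in place of Cauchy–Schwarz
  have hY := dotProduct_self_nonneg ((2 * (q : ℝ)⁻¹) • (Aᵀ *ᵥ w) - z)
  simp only [sub_dotProduct, dotProduct_sub, smul_dotProduct, dotProduct_smul, smul_eq_mul,
    dotProduct_comm z (Aᵀ *ᵥ w), ← hwz] at hY
  have hAw : (Aᵀ *ᵥ w) ⬝ᵥ (Aᵀ *ᵥ w) ≤ q * (w ⬝ᵥ w) / 2 := by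
    refine le_of_mul_le_mul_left ?_ hσ
    nlinarith [mul_nonneg hq'.le (dotProduct_self_nonneg w)]
  have hww : w ⬝ᵥ w ≤ q / 2 * (z ⬝ᵥ z) := by
    field_simp at hY
    nlinarith
  linarith

end Perturbation

/-! ### Stacked unfoldings -/

section Stack

variable {T q : ℕ} {κ : Type}

/-- The matrices `Z t` side by side. -/
def stack (Z : Fin T → Matrix (Fin q) κ ℝ) : Matrix (Fin q) (Fin T × κ) ℝ :=
  Matrix.of fun a tj => Z tj.1 a tj.2

lemma stack_mul_transpose [Fintype κ] (Z : Fin T → Matrix (Fin q) κ ℝ) :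
    stack Z * (stack Z)ᵀ = ∑ t, Z t * (Z t)ᵀ := by
  ext a b
  simp [stack, Matrix.mul_apply, Matrix.sum_apply, Fintype.sum_prod_type]

lemma stack_form [Fintype κ] (Z : Fin T → Matrix (Fin q) κ ℝ) (x : Fin q → ℝ) :
    ((stack Z)ᵀ *ᵥ x) ⬝ᵥ ((stack Z)ᵀ *ᵥ x) = ∑ t, ((Z t)ᵀ *ᵥ x) ⬝ᵥ ((Z t)ᵀ *ᵥ x) := by
  rw [dotProduct, Fintype.sum_prod_type]
  rfl

lemma stack_mul_add {r : ℕ} (A : Matrix (Fin q) (Fin r) ℝ) (H : Fin T → Matrix (Fin r) κ ℝ)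
    (N : Fin T → Matrix (Fin q) κ ℝ) :
    stack (fun t => A * H t + N t) = A * stack H + stack N := by
  ext a b
  simp [stack, Matrix.mul_apply]

end Stack

/-! ### Unfoldings of the model -/

section Unfolding

variable {K : ℕ}

lemma kronExcept_eq {d m : Fin K → ℕ} (k : Fin K)
    (A : ∀ l, Matrix (Fin (d l)) (Fin (m l)) ℝ) :
    kronExcept k A = kron (κ := fun l : {l // l ≠ k} => Fin (m l))
      (μ := fun l : {l // l ≠ k} => Fin (d l)) fun l => A l := rfl

lemma unfolding_modeProd {r d : Fin K → ℕ} (F : Tensor r)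
    (A : ∀ k, Matrix (Fin (d k)) (Fin (r k)) ℝ) (k : Fin K) :
    unfolding k (modeProd F A) = A k * unfolding k F * (kronExcept k A)ᵀ := by
  ext a b
  simp only [unfolding, modeProd, kronExcept, Matrix.of_apply, Matrix.mul_apply,
    Matrix.transpose_apply, Finset.sum_mul]
  rw [← (Equiv.piSplitAt k (fun l => Fin (r l))).symm.sum_comp, Fintype.sum_prod_type,
    Finset.sum_comm]
  refine Finset.sum_congr rfl fun y _ => Finset.sum_congr rfl fun x _ => ?_
  rw [Fintype.prod_eq_mul_prod_subtype_ne _ k]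
  have h : ∀ l : {l // l ≠ k}, A l ((Equiv.piSplitAt k (fun l => Fin (d l))).symm (a, b) l)
      ((Equiv.piSplitAt k (fun l => Fin (r l))).symm (x, y) l) = A l (b l) (y l) := by
    intro l
    simp [Equiv.piSplitAt, l.2]
  rw [Finset.prod_congr rfl fun l _ => h l]
  simp [Equiv.piSplitAt]
  ring

lemma unfolding_add {d : Fin K → ℕ} (k : Fin K) (X Y : Tensor d) :
    unfolding k (X + Y) = unfolding k X + unfolding k Y := rfl

lemma coDim_eq (d : Fin K → ℕ) (k : Fin K) : coDim d k = ∏ l : {l // l ≠ k}, d l :=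
  Finset.prod_subtype _ (by simp) _

lemma fullDim_eq (d : Fin K → ℕ) (k : Fin K) : fullDim d = d k * coDim d k :=
  (Finset.mul_prod_erase _ _ (Finset.mem_univ k)).symm

variable {T : ℕ} {r d : Fin K → ℕ}

/-- `1 / √(T p)`. -/
def scale (T : ℕ) (d : Fin K → ℕ) : ℝ := 1 / √((T : ℝ) * fullDim d)

lemma scale_mul_self (T : ℕ) (d : Fin K → ℕ) :
    scale T d * scale T d = 1 / ((T : ℝ) * fullDim d) := by
  rw [scale, div_mul_div_comm, one_mul, Real.mul_self_sqrt (by positivity)]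

lemma factorCov_form (F : Fin T → Tensor r) (k : Fin K) (hT : 0 < T) (z : Fin (r k) → ℝ) :
    ∑ t, ((unfolding k (F t))ᵀ *ᵥ z) ⬝ᵥ ((unfolding k (F t))ᵀ *ᵥ z) =
      T * (z ⬝ᵥ (factorCov F k *ᵥ z)) := by
  have hT' : (T : ℝ) ≠ 0 := by exact_mod_cast hT.ne'
  simp only [factorCov, Matrix.smul_mulVec, dotProduct_smul, smul_eq_mul, Matrix.sum_mulVec,
    dotProduct_sum]
  rw [← mul_assoc, mul_one_div_cancel hT', one_mul]
  refine Finset.sum_congr rfl fun t _ => ?_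
  rw [dotProduct_mulVec_mulVec, Matrix.transpose_transpose]

/-- The projected factors, stacked. -/
def signal {k : Fin K} {μ : {l // l ≠ k} → Type} (d : Fin K → ℕ) (F : Fin T → Tensor r)
    (C : ∀ l : {l // l ≠ k}, Matrix (μ l) (Fin (r l)) ℝ) :
    Matrix (Fin (r k)) (Fin T × (∀ l, μ l)) ℝ :=
  stack fun t => scale T d • (unfolding k (F t) * (kron C)ᵀ)

variable {k : Fin K} {μ : {l // l ≠ k} → Type} [∀ l, Fintype (μ l)]

lemma signal_form (F : Fin T → Tensor r) (C : ∀ l : {l // l ≠ k}, Matrix (μ l) (Fin (r l)) ℝ)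
    (z : Fin (r k) → ℝ) :
    ((signal d F C)ᵀ *ᵥ z) ⬝ᵥ ((signal d F C)ᵀ *ᵥ z) = 1 / ((T : ℝ) * fullDim d) *
      ∑ t, (kron C *ᵥ ((unfolding k (F t))ᵀ *ᵥ z)) ⬝ᵥ (kron C *ᵥ ((unfolding k (F t))ᵀ *ᵥ z)) := by
  rw [signal, stack_form, Finset.mul_sum]
  refine Finset.sum_congr rfl fun t _ => ?_
  rw [Matrix.transpose_smul, Matrix.smul_mulVec, Matrix.transpose_mul, Matrix.transpose_transpose,
    ← Matrix.mulVec_mulVec, smul_dotProduct, dotProduct_smul, smul_smul, smul_eq_mul,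
    scale_mul_self]

/-- Each of the other modes loses at most a factor 2, and the product of their `d l` cancels against
the normalization. -/
lemma le_signal_form {σ : ℝ} (hT : 0 < T) (hd : ∀ l, 0 < d l) {F : Fin T → Tensor r}
    {C : ∀ l : {l // l ≠ k}, Matrix (μ l) (Fin (r l)) ℝ}
    (hF : ∀ z, σ * (z ⬝ᵥ z) ≤ z ⬝ᵥ (factorCov F k *ᵥ z))
    (hC : ∀ (l : {l // l ≠ k}) z, (d l : ℝ) / 2 * (z ⬝ᵥ z) ≤ (C l *ᵥ z) ⬝ᵥ (C l *ᵥ z)) (z : Fin (r k) → ℝ) :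
    σ / 2 ^ Fintype.card {l // l ≠ k} * (z ⬝ᵥ z) ≤
      d k * (((signal d F C)ᵀ *ᵥ z) ⬝ᵥ ((signal d F C)ᵀ *ᵥ z)) := by
  have h1 : ∀ x, (coDim d k : ℝ) / 2 ^ Fintype.card {l // l ≠ k} * (x ⬝ᵥ x) ≤
      (kron C *ᵥ x) ⬝ᵥ (kron C *ᵥ x) := fun x => by
    have := le_kron_form (a := fun l : {l // l ≠ k} => (d l : ℝ) / 2) (fun l => by positivity) hC x
    rw [Finset.prod_div_distrib, Finset.prod_const, Finset.card_univ] at this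
    rwa [coDim_eq, Nat.cast_prod]
  have h2 := Finset.sum_le_sum fun t (_ : t ∈ Finset.univ) => h1 ((unfolding k (F t))ᵀ *ᵥ z)
  rw [← Finset.mul_sum, factorCov_form F k hT] at h2
  rw [signal_form, fullDim_eq d k]
  have hT' : (0 : ℝ) < T := by exact_mod_cast hT
  have hdk : (0 : ℝ) < d k := by exact_mod_cast hd k
  have hco : (0 : ℝ) < coDim d k := by
    exact_mod_cast Finset.prod_pos fun l _ => hd l
  set S := ∑ t, (kron C *ᵥ ((unfolding k (F t))ᵀ *ᵥ z)) ⬝ᵥ (kron C *ᵥ ((unfolding k (F t))ᵀ *ᵥ z))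
  have h3 : (d k : ℝ) * (1 / ((T : ℝ) * ((d k * coDim d k : ℕ) : ℝ)) * S) =
      S / (T * coDim d k) := by
    push_cast
    field_simp
  rw [h3, le_div_iff₀ (by positivity)]
  refine le_trans (le_of_eq_of_le ?_ (mul_le_mul_of_nonneg_left (hF z)
    (by positivity : 0 ≤ (coDim d k : ℝ) / 2 ^ Fintype.card {l // l ≠ k} * T)))
    (le_of_eq_of_le ?_ h2) <;> ring

lemma signal_form_le {C₀ : ℝ} (hT : 0 < T) (hd : ∀ l, 0 < d l) {F : Fin T → Tensor r}
    {C : ∀ l : {l // l ≠ k}, Matrix (μ l) (Fin (r l)) ℝ}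
    (hF : ∀ z, z ⬝ᵥ (factorCov F k *ᵥ z) ≤ C₀ * (z ⬝ᵥ z))
    (hC : ∀ l z, (C l *ᵥ z) ⬝ᵥ (C l *ᵥ z) ≤ (d l : ℝ) * (z ⬝ᵥ z)) (z : Fin (r k) → ℝ) :
    d k * (((signal d F C)ᵀ *ᵥ z) ⬝ᵥ ((signal d F C)ᵀ *ᵥ z)) ≤ C₀ * (z ⬝ᵥ z) := by
  have h1 : ∀ x, (kron C *ᵥ x) ⬝ᵥ (kron C *ᵥ x) ≤ (coDim d k : ℝ) * (x ⬝ᵥ x) := fun x => by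
    have := kron_form_le (b := fun l : {l // l ≠ k} => (d l : ℝ)) hC x
    rwa [coDim_eq, Nat.cast_prod]
  have h2 := Finset.sum_le_sum fun t (_ : t ∈ Finset.univ) => h1 ((unfolding k (F t))ᵀ *ᵥ z)
  rw [← Finset.mul_sum, factorCov_form F k hT] at h2
  rw [signal_form, fullDim_eq d k]
  have hT' : (0 : ℝ) < T := by exact_mod_cast hT
  have hdk : (0 : ℝ) < d k := by exact_mod_cast hd k
  have hco : (0 : ℝ) < coDim d k := by
    exact_mod_cast Finset.prod_pos fun l _ => hd l
  set S := ∑ t, (kron C *ᵥ ((unfolding k (F t))ᵀ *ᵥ z)) ⬝ᵥ (kron C *ᵥ ((unfolding k (F t))ᵀ *ᵥ z))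
  have h3 : (d k : ℝ) * (1 / ((T : ℝ) * ((d k * coDim d k : ℕ) : ℝ)) * S) =
      S / (T * coDim d k) := by
    push_cast
    field_simp
  rw [h3, div_le_iff₀ (by positivity)]
  refine h2.trans ((mul_le_mul_of_nonneg_left (mul_le_mul_of_nonneg_left (hF z) hT'.le)
    hco.le).trans_eq ?_)
  ring

lemma sampleCov_observations (A : ∀ k, Matrix (Fin (d k)) (Fin (r k)) ℝ) (F : Fin T → Tensor r)
    (E : Fin T → Tensor d) (k : Fin K) :
    sampleCov (observations A F E) k =
      noisyGram (A k) (signal (k := k) d F fun l => A l)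
        (stack fun t => scale T d • unfolding k (E t)) := by
  rw [noisyGram, signal, ← stack_mul_add, stack_mul_transpose, sampleCov, Finset.smul_sum]
  refine Finset.sum_congr rfl fun t _ => ?_
  have h : A k * scale T d • (unfolding k (F t) * (kron fun l : {l // l ≠ k} => A l)ᵀ) +
      scale T d • unfolding k (E t) = scale T d • unfolding k (observations A F E t) := by
    rw [observations, unfolding_add, unfolding_modeProd, Matrix.mul_smul, smul_add,
      ← Matrix.mul_assoc]
    rfl
  rw [h, Matrix.transpose_smul, Matrix.smul_mul, Matrix.mul_smul, smul_smul, scale_mul_self]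

/-- Projection changes factors and noise but not the loading of mode `k`, so the same perturbation
lemmas apply. The factors `√(d l)` absorb the extra `1 / p_{-k}`. -/
lemma projCov_observations (hd : ∀ l, 0 < d l) (A : ∀ k, Matrix (Fin (d k)) (Fin (r k)) ℝ)
    (F : Fin T → Tensor r) (E : Fin T → Tensor d) (k : Fin K) {m : Fin K → ℕ}
    (U : ∀ l, Matrix (Fin (d l)) (Fin (m l)) ℝ) :
    projCov (observations A F E) k (fun l => √(d l : ℝ) • U l) =
      noisyGram (A k) (signal (k := k) d F fun l => (U l)ᵀ * A l)
        (stack fun t => scale T d • (unfolding k (E t) * kronExcept k U)) := by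
  have hco : (0 : ℝ) < coDim d k := by
    exact_mod_cast Finset.prod_pos fun l _ => hd l
  have hs : (∏ l : {l // l ≠ k}, √(d l : ℝ)) * (∏ l : {l // l ≠ k}, √(d l : ℝ)) = coDim d k := by
    rw [← Finset.prod_mul_distrib, coDim_eq, Nat.cast_prod]
    exact Finset.prod_congr rfl fun l _ => Real.mul_self_sqrt (by positivity)
  rw [noisyGram, signal, ← stack_mul_add, stack_mul_transpose, projCov, Finset.smul_sum]
  refine Finset.sum_congr rfl fun t _ => ?_
  have h : A k * scale T d • (unfolding k (F t) * (kron fun l : {l // l ≠ k} => (U l)ᵀ * A l)ᵀ) +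
      scale T d • (unfolding k (E t) * kronExcept k U) =
      scale T d • (unfolding k (observations A F E t) * kronExcept k U) := by
    rw [observations, unfolding_add, unfolding_modeProd, Matrix.mul_smul, ← kron_mul,
      Matrix.transpose_mul, ← kron_transpose, Matrix.transpose_transpose, Matrix.add_mul, smul_add]
    simp only [Matrix.mul_assoc]
    rfl
  rw [h, kronExcept_eq, kron_smul, ← kronExcept_eq]
  simp only [Matrix.transpose_smul, Matrix.smul_mul, Matrix.mul_smul, smul_smul, scale_mul_self,
    Matrix.transpose_mul, Matrix.mul_assoc]
  congr 1
  rw [mul_assoc, hs]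
  field_simp

/-! ### Noise bounds -/

lemma kronExcept_orthonormal {m : Fin K → ℕ} {U : ∀ l, Matrix (Fin (d l)) (Fin (m l)) ℝ}
    (hU : ∀ l, (U l)ᵀ * U l = 1) (k : Fin K) : (kronExcept k U)ᵀ * kronExcept k U = 1 := by
  rw [kronExcept_eq, kron_transpose, kron_mul]
  simp only [hU]
  exact kron_one

/-- A bound for the projected noise that is uniform in the projection. -/
lemma projected_noise_form_le {m : Fin K → ℕ} {U : ∀ l, Matrix (Fin (d l)) (Fin (m l)) ℝ}
    (hU : ∀ l, (U l)ᵀ * U l = 1) (k : Fin K) {E : Fin T → Tensor d} {B : ℝ}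
    (hE : ∀ v : CoIndex d k → ℝ,
      ∑ t, (unfolding k (E t) *ᵥ v) ⬝ᵥ (unfolding k (E t) *ᵥ v) ≤ B * (v ⬝ᵥ v))
    (x : Fin (d k) → ℝ) :
    ((stack fun t => scale T d • (unfolding k (E t) * kronExcept k U))ᵀ *ᵥ x) ⬝ᵥ
      ((stack fun t => scale T d • (unfolding k (E t) * kronExcept k U))ᵀ *ᵥ x) ≤
      Fintype.card (CoIndex m k) * B / (T * fullDim d) * (x ⬝ᵥ x) := by
  set Q := kronExcept k U with hQ
  have hQQ : ∀ j, Q.col j ⬝ᵥ Q.col j = 1 := fun j => by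
    have := congrFun (congrFun (kronExcept_orthonormal hU k) j) j
    simpa [Matrix.mul_apply, dotProduct] using this
  -- Cauchy–Schwarz for each column of `Q` separately. Summing over columns costs only their number
  -- and leaves a bound valid for every `Q`, hence also for one that depends on the errors.
  have h1 : ∀ t, (((scale T d • (unfolding k (E t) * Q))ᵀ *ᵥ x) ⬝ᵥ
      ((scale T d • (unfolding k (E t) * Q))ᵀ *ᵥ x)) ≤ 1 / (T * fullDim d) *
        ∑ j, ((unfolding k (E t) *ᵥ Q.col j) ⬝ᵥ (unfolding k (E t) *ᵥ Q.col j)) * (x ⬝ᵥ x) := by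
    intro t
    rw [Matrix.transpose_smul, Matrix.smul_mulVec, smul_dotProduct, dotProduct_smul, smul_smul,
      smul_eq_mul, scale_mul_self]
    refine mul_le_mul_of_nonneg_left ?_ (by positivity)
    refine Finset.sum_le_sum fun j _ => ?_
    have := Finset.sum_mul_sq_le_sq_mul_sq Finset.univ (unfolding k (E t) *ᵥ Q.col j) x
    simp only [dotProduct, ← sq]
    exact this
  rw [stack_form]
  refine (Finset.sum_le_sum fun t _ => h1 t).trans ?_
  rw [← Finset.mul_sum, Finset.sum_comm]
  simp only [← Finset.sum_mul]
  have h2 := Finset.sum_le_sum fun j (_ : j ∈ Finset.univ) => hE (Q.col j)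
  simp only [hQQ, mul_one, Finset.sum_const, Finset.card_univ, nsmul_eq_mul] at h2
  refine (mul_le_mul_of_nonneg_left (mul_le_mul_of_nonneg_right h2 (dotProduct_self_nonneg x))
    (by positivity)).trans_eq ?_
  ring

lemma noise_form_le (k : Fin K) {E : Fin T → Tensor d} {B : ℝ}
    (hE : ∀ x : Fin (d k) → ℝ,
      ∑ t, ((unfolding k (E t))ᵀ *ᵥ x) ⬝ᵥ ((unfolding k (E t))ᵀ *ᵥ x) ≤ B * (x ⬝ᵥ x))
    (x : Fin (d k) → ℝ) :
    ((stack fun t => scale T d • unfolding k (E t))ᵀ *ᵥ x) ⬝ᵥ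
      ((stack fun t => scale T d • unfolding k (E t))ᵀ *ᵥ x) ≤
      B / (T * fullDim d) * (x ⬝ᵥ x) := by
  rw [stack_form]
  simp only [Matrix.transpose_smul, Matrix.smul_mulVec, smul_dotProduct, dotProduct_smul,
    smul_eq_mul, ← mul_assoc, scale_mul_self]
  rw [← Finset.mul_sum]
  refine (mul_le_mul_of_nonneg_left (hE x) (by positivity)).trans_eq ?_
  ring

end Unfolding

/-! ### The eigenvalue ratio -/

/-- For `ρ < r` the denominator is at least `λ_r ≥ κ`, so the ratio is at most `C / κ`. For `ρ > r`
the numerator is at most `λ_{r+1} ≤ η` and the denominator at least `δ`. Both bounds lie below `κ /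
(η + δ)`, which the ratio at `r` reaches. -/
lemma IsRatioArgmax.eq {q r rmax ρ : ℕ} {M : Matrix (Fin q) (Fin q) ℝ} (hM : M.IsHermitian)
    (hM0 : ∀ x, 0 ≤ x ⬝ᵥ (M *ᵥ x)) {δ κ η C : ℝ} (hδ : 0 < δ) (hκ : 0 < κ)
    (hr : 1 ≤ r) (hrmax : r ≤ rmax) (h1 : κ ≤ eigval M r) (h2 : eigval M (r + 1) ≤ η)
    (h3 : eigval M 1 ≤ C) (h4 : η * (η + δ) < κ * δ) (h5 : C * (η + δ) < κ * κ)
    (h : IsRatioArgmax M δ rmax ρ) : ρ = r := by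
  have h0 : ∀ j, 0 ≤ eigval M (j + 1) := eigval_nonneg hM hM0
  have hη : 0 ≤ η := (h0 r).trans h2
  have hle := h.2 r (Finset.mem_Icc.2 ⟨hr, hrmax⟩)
  have hρ1 : 1 ≤ ρ := (Finset.mem_Icc.1 h.1).1
  have hlow : κ / (η + δ) ≤ eigRatio M δ r :=
    div_le_div₀ (hκ.le.trans h1) h1 (by linarith [h0 r]) (by linarith)
  by_contra hne
  rcases lt_or_gt_of_ne hne with hlt | hgt
  · have hup : eigRatio M δ ρ ≤ C / κ :=
      div_le_div₀ ((h0 0).trans h3) ((eigval_antitone hM hM0 le_rfl hρ1).trans h3) hκ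
        (by linarith [eigval_antitone hM hM0 (i := ρ + 1) (j := r) (by omega) (by omega)])
    have : C / κ < κ / (η + δ) := by
      rw [div_lt_div_iff₀ hκ (by linarith)]
      exact h5
    linarith
  · have hup : eigRatio M δ ρ ≤ η / δ :=
      div_le_div₀ hη ((eigval_antitone hM hM0 (by omega) (by omega)).trans h2) hδ
        (by linarith [h0 ρ])
    have : η / δ < κ / (η + δ) := by
      rw [div_lt_div_iff₀ hδ (by linarith)]
      exact h4
    linarith

/-! ### Correctness of a run -/

lemma bessel {α β : Type*} [Fintype α] [Fintype β] [DecidableEq β] {U : Matrix α β ℝ}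
    (hU : Uᵀ * U = 1) (y : α → ℝ) : (Uᵀ *ᵥ y) ⬝ᵥ (Uᵀ *ᵥ y) ≤ y ⬝ᵥ y := by
  have h := dotProduct_self_nonneg (y - U *ᵥ (Uᵀ *ᵥ y))
  have h1 : y ⬝ᵥ (U *ᵥ (Uᵀ *ᵥ y)) = (Uᵀ *ᵥ y) ⬝ᵥ (Uᵀ *ᵥ y) := dotProduct_mulVec_self _ _ _
  simp only [sub_dotProduct, dotProduct_sub, orthonormal_dotProduct hU, h1,
    dotProduct_comm (U *ᵥ (Uᵀ *ᵥ y)) y] at h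
  linarith

/-- `L` is `√q` times a matrix with orthonormal columns, whose span is not too far from containing
the column span of `A`. -/
def Captures {q r m : ℕ} (A : Matrix (Fin q) (Fin r) ℝ) (L : Matrix (Fin q) (Fin m) ℝ) : Prop :=
  ∃ U : Matrix (Fin q) (Fin m) ℝ, Uᵀ * U = 1 ∧ L = √(q : ℝ) • U ∧
    ∀ z, (q : ℝ) / 2 * (z ⬝ᵥ z) ≤ ((Uᵀ * A) *ᵥ z) ⬝ᵥ ((Uᵀ * A) *ᵥ z)

variable {K T rmax : ℕ} {r d : Fin K → ℕ}

/-- Deterministic conditions under which every run of the algorithm is correct. -/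
structure IsGood (rmax : ℕ) (A : ∀ k, Matrix (Fin (d k)) (Fin (r k)) ℝ)
    (F : Fin T → Tensor r) (E : Fin T → Tensor d) (δ : Fin K → ℝ) (σ C₀ : ℝ)
    (η₀ η : Fin K → ℝ) : Prop where
  T_pos : 0 < T
  r_pos : ∀ k, 1 ≤ r k
  r_lt : ∀ k, r k < rmax
  rmax_le : ∀ k, rmax ≤ d k
  σ_pos : 0 < σ
  C_nonneg : 0 ≤ C₀
  δ_pos : ∀ k, 0 < δ k
  η_nonneg : ∀ k, 0 ≤ η k
  loading : ∀ k, (A k)ᵀ * A k = (d k : ℝ) • 1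
  le_factor : ∀ k z, σ * 2 ^ (K - 1) * (z ⬝ᵥ z) ≤ z ⬝ᵥ (factorCov F k *ᵥ z)
  factor_le : ∀ k z, z ⬝ᵥ (factorCov F k *ᵥ z) ≤ C₀ * (z ⬝ᵥ z)
  noise₀ : ∀ k x, ∑ t, ((unfolding k (E t))ᵀ *ᵥ x) ⬝ᵥ ((unfolding k (E t))ᵀ *ᵥ x) ≤
    η₀ k * (T * fullDim d) * (x ⬝ᵥ x)
  noise : ∀ k v, ∑ t, (unfolding k (E t) *ᵥ v) ⬝ᵥ (unfolding k (E t) *ᵥ v) ≤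
    η k / (rmax + 2) ^ (K - 1) * (T * fullDim d) * (v ⬝ᵥ v)
  η₀_le : ∀ k, 8 * η₀ k ≤ σ
  η_le : ∀ k, 8 * η k ≤ σ
  ratio₁ : ∀ k, η k * (η k + δ k) < σ / 4 * δ k
  ratio₂ : ∀ k, (2 * C₀ + 2 * η k) * (η k + δ k) < σ / 4 * (σ / 4)

namespace IsGood

variable {A : ∀ k, Matrix (Fin (d k)) (Fin (r k)) ℝ}
    {F : Fin T → Tensor r} {E : Fin T → Tensor d} {δ : Fin K → ℝ} {σ C₀ : ℝ}
    {η₀ η : Fin K → ℝ}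

lemma card_ne (k : Fin K) : Fintype.card {l // l ≠ k} = K - 1 := by
  simp [Fintype.card_subtype_compl]

lemma d_pos (h : IsGood rmax A F E δ σ C₀ η₀ η) (k : Fin K) : 0 < d k :=
  (h.r_pos k).trans ((h.r_lt k).le.trans (h.rmax_le k))

lemma sample_pos (h : IsGood rmax A F E δ σ C₀ η₀ η) : 0 < (T : ℝ) * fullDim d := by
  have h1 : 0 < fullDim d := Finset.prod_pos fun l _ => h.d_pos l
  have h2 := h.T_pos
  positivity

lemma le_signal (h : IsGood rmax A F E δ σ C₀ η₀ η) {k : Fin K} {μ : {l // l ≠ k} → Type}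
    [∀ l, Fintype (μ l)] {C : ∀ l : {l // l ≠ k}, Matrix (μ l) (Fin (r l)) ℝ}
    (hC : ∀ (l : {l // l ≠ k}) z, (d l : ℝ) / 2 * (z ⬝ᵥ z) ≤ (C l *ᵥ z) ⬝ᵥ (C l *ᵥ z))
    (z : Fin (r k) → ℝ) :
    σ * (z ⬝ᵥ z) ≤ d k * (((signal d F C)ᵀ *ᵥ z) ⬝ᵥ ((signal d F C)ᵀ *ᵥ z)) := by
  have := le_signal_form h.T_pos h.d_pos (h.le_factor k) hC z
  rwa [card_ne, mul_div_cancel_right₀ _ (by positivity)] at this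

lemma captures_init (h : IsGood rmax A F E δ σ C₀ η₀ η) (k : Fin K) {m : ℕ} (hm : r k ≤ m)
    {L : Matrix (Fin (d k)) (Fin m) ℝ}
    (hL : IsLeadingEigenvectors (sampleCov (observations A F E) k) L) : Captures (A k) L := by
  obtain ⟨U, hU, hUM, rfl⟩ := hL
  rw [sampleCov_observations] at hUM
  refine ⟨U, hU, rfl, le_capture (h.r_pos k) ((h.r_lt k).le.trans (h.rmax_le k)) (h.loading k)
    h.σ_pos (h.le_signal fun l z => ?_) (h.η₀_le k) (fun x => ?_) hm hU hUM⟩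
  -- Without projection the other modes enter through `A l` itself, whose form is exactly `d l`,
  -- more than the required half.
  · rw [loading_form (h.loading l)]
    have := mul_nonneg (Nat.cast_nonneg (α := ℝ) (d l)) (dotProduct_self_nonneg z)
    linarith
  · refine (noise_form_le k (h.noise₀ k) x).trans_eq ?_
    rw [mul_div_cancel_right₀ _ h.sample_pos.ne']

/-- One update. About the current loadings it uses only that they capture the true ones and have at
most `rmax + 2` columns, so the history of the run is irrelevant. -/
lemma projected (h : IsGood rmax A F E δ σ C₀ η₀ η) (k : Fin K) {m : Fin K → ℕ}
    (hm : ∀ l, m l ≤ rmax + 2) {L : ∀ l, Matrix (Fin (d l)) (Fin (m l)) ℝ}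
    (hL : ∀ l, Captures (A l) (L l)) :
    (∀ ρ, IsRatioArgmax (projCov (observations A F E) k L) (δ k) rmax ρ → ρ = r k) ∧
    ∀ (m' : ℕ) (L' : Matrix (Fin (d k)) (Fin m') ℝ), r k ≤ m' →
      IsLeadingEigenvectors (projCov (observations A F E) k L) L' → Captures (A k) L' := by
  choose U hU hUL hUA using hL
  obtain rfl : L = fun l => √(d l : ℝ) • U l := funext hUL
  rw [projCov_observations h.d_pos]
  have hrk := (h.r_lt k).le.trans (h.rmax_le k)
  have hup : ∀ (l : {l // l ≠ k}) z, (((U l)ᵀ * A l) *ᵥ z) ⬝ᵥ (((U l)ᵀ * A l) *ᵥ z) ≤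
      (d l : ℝ) * (z ⬝ᵥ z) := fun l z => by
    rw [← Matrix.mulVec_mulVec, ← loading_form (h.loading l)]
    exact bessel (hU l) _
  have hlow := h.le_signal (k := k) (fun l => hUA l)
  have hhigh := signal_form_le h.T_pos h.d_pos (h.factor_le k) hup
  have hN : ∀ x, ((stack fun t => scale T d • (unfolding k (E t) * kronExcept k U))ᵀ *ᵥ x) ⬝ᵥ
      ((stack fun t => scale T d • (unfolding k (E t) * kronExcept k U))ᵀ *ᵥ x) ≤
      η k * (x ⬝ᵥ x) := fun x => by
    refine (projected_noise_form_le hU k (h.noise k) x).trans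
      (mul_le_mul_of_nonneg_right ?_ (dotProduct_self_nonneg x))
    have hcard : (Fintype.card (CoIndex m k) : ℝ) ≤ (rmax + 2) ^ (K - 1) := by
      rw [← card_ne k, Fintype.card_pi]
      push_cast
      rw [← Finset.card_univ, ← Finset.prod_const]
      refine Finset.prod_le_prod (fun l _ => by positivity) fun l _ => ?_
      simpa using (by exact_mod_cast hm l : (m l : ℝ) ≤ rmax + 2)
    have hη := h.η_nonneg k
    rw [← mul_assoc, mul_div_cancel_right₀ _ h.sample_pos.ne', mul_div_assoc',
      div_le_iff₀ (by positivity), mul_comm]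
    exact mul_le_mul_of_nonneg_left hcard hη
  constructor
  · intro ρ hρ
    have hσ := h.σ_pos
    refine hρ.eq (κ := σ / 4) noisyGram_isHermitian noisyGram_form_nonneg (h.δ_pos k)
      (by linarith) (h.r_pos k) (h.r_lt k).le
      (le_trans (by linarith [h.η_le k]) (le_eigval_noisyGram (h.r_pos k) hrk (h.loading k) hlow hN))
      (eigval_noisyGram_le (h.η_nonneg k) hN)
      (eigval_noisyGram_le_const (h.d_pos k) (h.loading k) (h.η_nonneg k) h.C_nonneg hhigh hN 0)
      (h.ratio₁ k) (h.ratio₂ k)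
  · rintro m' L' hm' ⟨U', hU', hUM', rfl⟩
    exact ⟨U', hU', rfl, le_capture (h.r_pos k) hrk (h.loading k) h.σ_pos hlow (h.η_le k) hN hm'
      hU' hUM'⟩

/-- Induction over sweeps, and within a sweep over modes, since mode `k` already uses the new
loadings of the modes before it. -/
theorem rhat_eq {c : ℝ}
    (h : IsGood rmax A F E (fun k => c * (rateOmega T d k : ℝ) ^ (-(1 / 2) : ℝ)) σ C₀ η₀ η)
    (run : IPERun c rmax (observations A F E)) (s : ℕ) (k : Fin K) :
    run.rhat (s + 1) k = r k := by
  have hcols : ∀ s k, run.cols s k ≤ rmax + 2 := by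
    intro s k
    cases s with
    | zero => rw [run.cols_zero]; omega
    | succ s =>
      have := (Finset.mem_Icc.1 (run.rhat_succ s k).1).2
      rw [run.cols_succ]; omega
  have hstep : ∀ s, (∀ k, Captures (A k) (run.loading s k)) →
      ∀ k, run.rhat (s + 1) k = r k ∧ Captures (A k) (run.loading (s + 1) k) := by
    intro s hs k
    induction k using WellFoundedLT.induction with
    | ind k ih =>
      have hcap : ∀ l, Captures (A l) (run.loading (sweepIndex s k l) l) := by
        intro l
        by_cases hlk : l < k
        · rw [show sweepIndex s k l = s + 1 from if_pos hlk]
          exact (ih l hlk).2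
        · rw [show sweepIndex s k l = s from if_neg hlk]
          exact hs l
      have hp := h.projected k (fun l => hcols (sweepIndex s k l) l) hcap
      have hr := hp.1 _ (run.rhat_succ s k)
      refine ⟨hr, hp.2 _ _ ?_ (run.loading_succ s k)⟩
      have := h.r_lt k
      have := h.rmax_le k
      -- As the rank is now known to be correct, `min (r k + 2) (d k)` columns are kept, which is at
      -- least `r k`.
      rw [run.cols_succ, hr]
      omega
  have hall : ∀ s k, Captures (A k) (run.loading s k) := by
    intro s
    induction s with
    | zero =>
      intro k
      refine h.captures_init k ?_ (run.loading_zero k)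
      have := h.r_lt k
      have := h.rmax_le k
      rw [run.cols_zero]
      omega
    | succ s ih => exact fun k => (hstep s ih k).2
  exact (hstep s (hall s) k).1

end IsGood

/-! ### A bound for random matrices with independent entries -/

section RandomMatrix

variable {α β Ω : Type*}

/-- An operator norm bound through the Frobenius norm of the centred Gram matrix. -/
lemma gram_form_le [Fintype α] [Fintype β] (z : α × β → ℝ) (g : β → β → ℝ) {s l : ℝ} (hl : 0 ≤ l)
    (hg0 : ∀ b b', b ≠ b' → g b b' = 0) (hg : ∀ b, g b b ≤ s)
    (hD : ∑ b, ∑ b', (∑ a, z (a, b) * z (a, b') - g b b') ^ 2 ≤ l ^ 2) (v : β → ℝ) :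
    ∑ a, (∑ b, z (a, b) * v b) ^ 2 ≤ (s + l) * (v ⬝ᵥ v) := by
  have h1 : ∑ a, (∑ b, z (a, b) * v b) ^ 2 =
      ∑ b, ∑ b', g b b' * (v b * v b') +
      ∑ b, ∑ b', (∑ a, z (a, b) * z (a, b') - g b b') * (v b * v b') := by
    simp only [← Finset.sum_add_distrib, ← add_mul, add_sub_cancel]
    simp only [sq, Finset.sum_mul_sum]
    simp only [Finset.sum_mul]
    rw [Finset.sum_comm]
    refine Finset.sum_congr rfl fun b _ => ?_
    rw [Finset.sum_comm]
    exact Finset.sum_congr rfl fun b' _ => Finset.sum_congr rfl fun a _ => by ring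
  have h2 : ∑ b, ∑ b', g b b' * (v b * v b') ≤ s * (v ⬝ᵥ v) := by
    rw [dotProduct, Finset.mul_sum]
    refine Finset.sum_le_sum fun b _ => ?_
    rw [Finset.sum_eq_single b (fun b' _ hb => by rw [hg0 b b' hb.symm, zero_mul])
      (fun hb => absurd (Finset.mem_univ b) hb)]
    exact mul_le_mul_of_nonneg_right (hg b) (mul_self_nonneg _)
  have h3 : ∑ b, ∑ b', (∑ a, z (a, b) * z (a, b') - g b b') * (v b * v b') ≤ l * (v ⬝ᵥ v) := by
    have hv := dotProduct_self_nonneg v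
    refine abs_le_of_sq_le_sq' ?_ (mul_nonneg hl hv) |>.2
    -- Cauchy–Schwarz against `v ⊗ v`, whose squared norm is `(v ⬝ᵥ v) ^ 2`.
    have hcs := Finset.sum_mul_sq_le_sq_mul_sq (Finset.univ : Finset (β × β))
      (fun p => ∑ a, z (a, p.1) * z (a, p.2) - g p.1 p.2) (fun p => v p.1 * v p.2)
    simp only [Fintype.sum_prod_type] at hcs
    have hvv : ∑ b, ∑ b', (v b * v b') ^ 2 = (v ⬝ᵥ v) ^ 2 := by
      rw [dotProduct, sq, Finset.sum_mul_sum]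
      exact Finset.sum_congr rfl fun b _ => Finset.sum_congr rfl fun b' _ => by ring
    rw [hvv] at hcs
    rw [mul_pow]
    exact hcs.trans (mul_le_mul_of_nonneg_right hD (sq_nonneg _))
  rw [h1]
  linarith

variable [MeasurableSpace Ω] {P : Measure Ω} {Z : α × β → Ω → ℝ}

lemma integrable_sq_mul_sq (hZ : ∀ i, Measurable (Z i)) (h4 : ∀ i, Integrable (fun ω => Z i ω ^ 4) P)
    (i j : α × β) : Integrable (fun ω => (Z i ω * Z j ω) ^ 2) P := by
  refine ((h4 i).add (h4 j)).mono' ((hZ i).mul (hZ j) |>.pow_const 2).aestronglyMeasurable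
    (Eventually.of_forall fun ω => ?_)
  rw [Real.norm_of_nonneg (sq_nonneg _)]
  simp only [Pi.add_apply]
  nlinarith [sq_nonneg (Z i ω ^ 2 - Z j ω ^ 2), sq_nonneg (Z i ω ^ 2), sq_nonneg (Z j ω ^ 2)]

lemma integral_sq_mul_sq_le (hZ : ∀ i, Measurable (Z i))
    (h4 : ∀ i, Integrable (fun ω => Z i ω ^ 4) P) {κ : ℝ} (h4' : ∀ i, ∫ ω, Z i ω ^ 4 ∂P ≤ κ)
    (i j : α × β) : ∫ ω, (Z i ω * Z j ω) ^ 2 ∂P ≤ κ := by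
  have h : ∫ ω, (Z i ω * Z j ω) ^ 2 ∂P ≤ ∫ ω, (Z i ω ^ 4 / 2 + Z j ω ^ 4 / 2) ∂P :=
    integral_mono (integrable_sq_mul_sq hZ h4 i j) (((h4 i).div_const 2).add ((h4 j).div_const 2))
      fun ω => by
        simp only
        nlinarith [sq_nonneg (Z i ω ^ 2 - Z j ω ^ 2)]
  rw [integral_add ((h4 i).div_const 2) ((h4 j).div_const 2), integral_div, integral_div] at h
  linarith [h4' i, h4' j]

/-- The mean Gram matrix is diagonal with entries at most `|α| s`. Each of the `|β|²` entries has
variance at most `|α| κ`, so Markov's inequality bounds the squared Frobenius norm of the deviation.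
-/
lemma measure_form_gt_le [Fintype α] [Fintype β] [IsProbabilityMeasure P] (hZ : ∀ i, Measurable (Z i)) (hind : iIndepFun Z P)
    (h0 : ∀ i, ∫ ω, Z i ω ∂P = 0) {s κ : ℝ}
    (h2 : ∀ i, ∫ ω, Z i ω ^ 2 ∂P ≤ s)
    (h4 : ∀ i, Integrable (fun ω => Z i ω ^ 4) P) (h4' : ∀ i, ∫ ω, Z i ω ^ 4 ∂P ≤ κ)
    {l : ℝ} (hl : 0 < l) :
    P {ω | ∃ v : β → ℝ, (Fintype.card α * s + l) * (v ⬝ᵥ v) <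
      ∑ a, (∑ b, Z (a, b) ω * v b) ^ 2} ≤
      ENNReal.ofReal (Fintype.card α * Fintype.card β ^ 2 * κ / l ^ 2) := by
  classical
  let Y : β → β → α → Ω → ℝ := fun b b' a => Z (a, b) * Z (a, b')
  have hYm : ∀ b b' a, Measurable (Y b b' a) := fun b b' a => (hZ _).mul (hZ _)
  have hY2 : ∀ b b' a, MemLp (Y b b' a) 2 P := fun b b' a =>
    (memLp_two_iff_integrable_sq (hYm b b' a).aestronglyMeasurable).2
      (integrable_sq_mul_sq hZ h4 _ _)
  let S : β → β → Ω → ℝ := fun b b' => ∑ a, Y b b' a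
  have hS2 : ∀ b b', MemLp (S b b') 2 P := fun b b' => memLp_finsetSum' _ fun a _ => hY2 b b' a
  let g : β → β → ℝ := fun b b' => ∫ ω, S b b' ω ∂P
  have hgsum : ∀ b b', g b b' = ∑ a, ∫ ω, Y b b' a ω ∂P := fun b b' => by
    simp only [g, S, Finset.sum_apply]
    exact integral_finsetSum _ fun a _ => (hY2 b b' a).integrable (by norm_num)
  have hg0 : ∀ b b', b ≠ b' → g b b' = 0 := fun b b' hb => by
    rw [hgsum]
    refine Finset.sum_eq_zero fun a _ => ?_
    have hi : IndepFun (Z (a, b)) (Z (a, b')) P := hind.indepFun (by simpa using hb)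
    rw [hi.integral_mul_eq_mul_integral (hZ _).aestronglyMeasurable (hZ _).aestronglyMeasurable,
      h0, zero_mul]
  have hgs : ∀ b, g b b ≤ Fintype.card α * s := fun b => by
    rw [hgsum, ← nsmul_eq_mul, ← Finset.card_univ]
    refine Finset.sum_le_card_nsmul _ _ _ fun a _ => ?_
    simpa [Y, sq] using h2 (a, b)
  let D : Ω → ℝ := fun ω => ∑ b, ∑ b', (S b b' ω - g b b') ^ 2
  have hDi : ∀ b b', Integrable (fun ω => (S b b' ω - g b b') ^ 2) P := fun b b' =>
    ((hS2 b b').sub (memLp_const _)).integrable_sq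
  have hDint : Integrable D P :=
    integrable_finsetSum _ fun b _ => integrable_finsetSum _ fun b' _ => hDi b b'
  have hvar : ∀ b b', ∫ ω, (S b b' ω - g b b') ^ 2 ∂P ≤ Fintype.card α * κ := fun b b' => by
    -- Products for distinct `a` involve disjoint sets of entries, hence are independent and their
    -- variances add.
    rw [← variance_eq_integral (hS2 b b').aemeasurable, IndepFun.variance_sum (fun a _ => hY2 b b' a)
      (fun a _ a' _ ha => hind.indepFun_mul_mul hZ _ _ _ _ (by simp [ha]) (by simp [ha])
        (by simp [ha]) (by simp [ha])), ← nsmul_eq_mul, ← Finset.card_univ]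
    refine Finset.sum_le_card_nsmul _ _ _ fun a _ => ?_
    exact (variance_le_expectation_sq (hYm b b' a).aestronglyMeasurable).trans
      (integral_sq_mul_sq_le hZ h4 h4' _ _)
  have hED : ∫ ω, D ω ∂P ≤ Fintype.card α * Fintype.card β ^ 2 * κ := by
    simp only [D]
    rw [integral_finsetSum _ fun b _ => integrable_finsetSum _ fun b' _ => hDi b b']
    simp only [integral_finsetSum _ fun b' _ => hDi _ b']
    refine (Finset.sum_le_sum fun b _ => Finset.sum_le_sum fun b' _ => hvar b b').trans_eq ?_
    simp only [Finset.sum_const, Finset.card_univ, nsmul_eq_mul]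
    ring
  have hsub : {ω | ∃ v : β → ℝ, (Fintype.card α * s + l) * (v ⬝ᵥ v) <
      ∑ a, (∑ b, Z (a, b) ω * v b) ^ 2} ⊆ {ω | l ^ 2 ≤ D ω} := by
    rintro ω ⟨v, hv⟩
    by_contra hlt
    simp only [Set.mem_ofPred_eq, not_le] at hlt
    refine hv.not_ge (gram_form_le (fun i => Z i ω) g hl.le hg0 hgs ?_ v)
    refine le_of_eq_of_le ?_ hlt.le
    simp [D, S, Y]
  refine (measure_mono hsub).trans ?_
  have hM := mul_meas_ge_le_integral_of_nonneg
    (Eventually.of_forall fun ω => Finset.sum_nonneg fun b _ => Finset.sum_nonneg fun b' _ =>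
      sq_nonneg (S b b' ω - g b b')) hDint (l ^ 2)
  rw [← ENNReal.ofReal_toReal (measure_ne_top P {ω | l ^ 2 ≤ D ω})]
  refine ENNReal.ofReal_le_ofReal ?_
  rw [le_div_iff₀ (by positivity), mul_comm]
  exact hM.trans hED

end RandomMatrix

/-! ### The error tensors -/

section Noise

variable {K T : ℕ} {d : Fin K → ℕ} {Ω : Type*} [MeasurableSpace Ω] {P : Measure Ω}
  [IsProbabilityMeasure P] {E : Fin T → Ω → Tensor d} {s κ l : ℝ}

lemma card_coIndex (d : Fin K → ℕ) (k : Fin K) : Fintype.card (CoIndex d k) = coDim d k := by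
  rw [coDim_eq, Fintype.card_pi]
  simp

lemma measure_projected_noise_le (hE : ∀ t i, Measurable fun ω => E t ω i)
    (hind : iIndepFun (fun (ti : Fin T × ((k : Fin K) → Fin (d k))) ω => E ti.1 ω ti.2) P)
    (h0 : ∀ t i, ∫ ω, E t ω i ∂P = 0) (h2 : ∀ t i, ∫ ω, E t ω i ^ 2 ∂P ≤ s)
    (h4 : ∀ t i, Integrable (fun ω => E t ω i ^ 4) P)
    (h4' : ∀ t i, ∫ ω, E t ω i ^ 4 ∂P ≤ κ) (hl : 0 < l) (k : Fin K) :
    P {ω | ∃ v, ((T * d k : ℕ) * s + l) * (v ⬝ᵥ v) <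
      ∑ t, (unfolding k (E t ω) *ᵥ v) ⬝ᵥ (unfolding k (E t ω) *ᵥ v)} ≤
      ENNReal.ofReal ((T * d k : ℕ) * (coDim d k : ℝ) ^ 2 * κ / l ^ 2) := by
  let e := fun x : (Fin T × Fin (d k)) × CoIndex d k =>
    (x.1.1, (Equiv.piSplitAt k (fun l => Fin (d l))).symm (x.1.2, x.2))
  have he : Function.Injective e := by
    rintro ⟨⟨t, a⟩, b⟩ ⟨⟨t', a'⟩, b'⟩ h
    simp only [e, Prod.mk.injEq, EmbeddingLike.apply_eq_iff_eq] at h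
    simp [h]
  have h := measure_form_gt_le (fun x => hE (e x).1 (e x).2) (hind.precomp he)
    (fun x => h0 _ _) (fun x => h2 _ _) (fun x => h4 _ _) (fun x => h4' _ _) hl
  rw [card_coIndex, Fintype.card_prod, Fintype.card_fin, Fintype.card_fin] at h
  refine le_of_eq_of_le ?_ h
  congr 1
  ext ω
  simp only [Fintype.sum_prod_type, dotProduct, Matrix.mulVec, ← sq]
  rfl

lemma measure_noise_le (hE : ∀ t i, Measurable fun ω => E t ω i)
    (hind : iIndepFun (fun (ti : Fin T × ((k : Fin K) → Fin (d k))) ω => E ti.1 ω ti.2) P)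
    (h0 : ∀ t i, ∫ ω, E t ω i ∂P = 0) (h2 : ∀ t i, ∫ ω, E t ω i ^ 2 ∂P ≤ s)
    (h4 : ∀ t i, Integrable (fun ω => E t ω i ^ 4) P)
    (h4' : ∀ t i, ∫ ω, E t ω i ^ 4 ∂P ≤ κ) (hl : 0 < l) (k : Fin K) :
    P {ω | ∃ v, ((T * coDim d k : ℕ) * s + l) * (v ⬝ᵥ v) <
      ∑ t, ((unfolding k (E t ω))ᵀ *ᵥ v) ⬝ᵥ ((unfolding k (E t ω))ᵀ *ᵥ v)} ≤
      ENNReal.ofReal ((T * coDim d k : ℕ) * (d k : ℝ) ^ 2 * κ / l ^ 2) := by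
  let e := fun x : (Fin T × CoIndex d k) × Fin (d k) =>
    (x.1.1, (Equiv.piSplitAt k (fun l => Fin (d l))).symm (x.2, x.1.2))
  have he : Function.Injective e := by
    rintro ⟨⟨t, a⟩, b⟩ ⟨⟨t', a'⟩, b'⟩ h
    simp only [e, Prod.mk.injEq, EmbeddingLike.apply_eq_iff_eq] at h
    simp [h]
  have h := measure_form_gt_le (fun x => hE (e x).1 (e x).2) (hind.precomp he)
    (fun x => h0 _ _) (fun x => h2 _ _) (fun x => h4 _ _) (fun x => h4' _ _) hl
  rw [Fintype.card_prod, card_coIndex, Fintype.card_fin, Fintype.card_fin] at h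
  refine le_of_eq_of_le ?_ h
  congr 1
  ext ω
  simp only [Fintype.sum_prod_type, dotProduct, Matrix.mulVec, ← sq]
  rfl

end Noise

/-! ### Asymptotics of the rates -/

section Rates

variable {K : ℕ} {T : ℕ → ℕ} {p : ℕ → Fin K → ℕ}

lemma le_coDim (hK : 2 ≤ K) {d : Fin K → ℕ} {N : ℕ} (hN : 1 ≤ N) (hd : ∀ l, N ≤ d l) (k : Fin K) :
    N ≤ coDim d k := by
  obtain ⟨l, hl⟩ : ∃ l, l ≠ k := by
    have : Nontrivial (Fin K) := Fin.nontrivial_iff_two_le.2 hK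
    exact exists_ne k
  exact (hd l).trans (Finset.single_le_prod' (f := d) (fun i _ => hN.trans (hd i))
    (Finset.mem_erase.2 ⟨hl, Finset.mem_univ l⟩))

lemma tendsto_coDim (hK : 2 ≤ K) (hp : ∀ k, Tendsto (fun n => p n k) atTop atTop) (k : Fin K) :
    Tendsto (fun n => coDim (p n) k) atTop atTop := by
  refine tendsto_atTop.2 fun N => ?_
  filter_upwards [eventually_all.2 fun l => (hp l).eventually_ge_atTop (max N 1)] with n hn
  exact (le_max_left _ _).trans (le_coDim hK (le_max_right _ _) hn k)

lemma tendsto_rateOmega (hK : 2 ≤ K) (hT : Tendsto T atTop atTop)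
    (hp : ∀ k, Tendsto (fun n => p n k) atTop atTop) (k : Fin K) :
    Tendsto (fun n => rateOmega (T n) (p n) k) atTop atTop := by
  refine tendsto_atTop.2 fun N => ?_
  filter_upwards [eventually_all.2 fun l => (hp l).eventually_ge_atTop (max N 1),
    hT.eventually_ge_atTop (max N 1)] with n hn hTn
  have h1 : 1 ≤ max N 1 := le_max_right _ _
  have hco : ∀ l, max N 1 ≤ coDim (p n) l := le_coDim hK h1 hn
  have hmul : ∀ a b : ℕ, max N 1 ≤ a → max N 1 ≤ b → max N 1 ≤ a * b := fun a b ha hb =>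
    ha.trans (Nat.le_mul_of_pos_right a (h1.trans hb))
  have : Nonempty (Fin K) := ⟨k⟩
  refine (le_max_left N 1).trans (le_min (le_min (hmul _ _ (hn k) hTn) ?_) (le_min ?_ ?_))
  · rw [sq]
    exact hmul _ _ (hco k) (hco k)
  · rw [fullDim_eq _ k]
    exact hmul _ _ (hn k) (hco k)
  · exact le_ciInf fun l => hmul _ _ hTn (hco l)

/-- The penalty term. -/
def penalty (c : ℝ) (T : ℕ) (d : Fin K → ℕ) (k : Fin K) : ℝ :=
  c * (rateOmega T d k : ℝ) ^ (-(1 / 2) : ℝ)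

lemma penalty_pos {c : ℝ} (hc : 0 < c) {T : ℕ} {d : Fin K → ℕ} {k : Fin K}
    (h : 0 < rateOmega T d k) : 0 < penalty c T d k :=
  mul_pos hc (Real.rpow_pos_of_pos (by exact_mod_cast h) _)

lemma tendsto_penalty (hK : 2 ≤ K) (hT : Tendsto T atTop atTop)
    (hp : ∀ k, Tendsto (fun n => p n k) atTop atTop) (c : ℝ) (k : Fin K) :
    Tendsto (fun n => penalty c (T n) (p n) k) atTop (𝓝 0) := by
  have h := (tendsto_rpow_neg_atTop (y := 1 / 2) (by norm_num)).comp
    (tendsto_natCast_atTop_atTop.comp (tendsto_rateOmega hK hT hp k))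
  simpa [penalty] using h.const_mul c

/-- Used with `x = p_{-k}` and `x = √(p_k T)`, two of the bounds built into `ω_k`. -/
lemma le_penalty_of_le_sq {c : ℝ} (hc : 0 < c) {T : ℕ} {d : Fin K → ℕ} {k : Fin K}
    (h : 0 < rateOmega T d k) {x : ℝ} (hx : 0 < x) (hle : (rateOmega T d k : ℝ) ≤ x ^ 2) :
    c / x ≤ penalty c T d k := by
  have h' : (0 : ℝ) < rateOmega T d k := by exact_mod_cast h
  rw [penalty, div_eq_mul_inv]
  refine mul_le_mul_of_nonneg_left ?_ hc.le
  rw [Real.rpow_neg h'.le, ← Real.sqrt_eq_rpow]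
  exact inv_anti₀ (Real.sqrt_pos.2 h') (Real.sqrt_le_iff.2 ⟨hx.le, hle⟩)

lemma div_coDim_le_penalty {c : ℝ} (hc : 0 < c) {T : ℕ} {d : Fin K → ℕ} {k : Fin K}
    (h : 0 < rateOmega T d k) (hx : 0 < coDim d k) : c / coDim d k ≤ penalty c T d k := by
  refine le_penalty_of_le_sq hc h (by exact_mod_cast hx) ?_
  exact_mod_cast (min_le_left _ _).trans (min_le_right _ _)

lemma div_sqrt_le_penalty {c : ℝ} (hc : 0 < c) {T : ℕ} {d : Fin K → ℕ} {k : Fin K}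
    (h : 0 < rateOmega T d k) (hx : 0 < d k * T) :
    c / √((d k * T : ℕ) : ℝ) ≤ penalty c T d k := by
  have hx' : (0 : ℝ) < (d k * T : ℕ) := by exact_mod_cast hx
  refine le_penalty_of_le_sq hc h (Real.sqrt_pos.2 hx') ?_
  rw [Real.sq_sqrt hx'.le]
  exact_mod_cast (min_le_left _ _).trans (min_le_left _ _)

end Rates

/-! ### Consequences of the assumptions -/

section Assumptions

variable {K : ℕ} {r : Fin K → ℕ} {𝒜 : ∀ k, Set (Fin (r k) → ℝ)} {ℱ : Set (Tensor r)}
  {T : ℕ → ℕ} {p : ℕ → Fin K → ℕ} {A₀ : ∀ n k, Matrix (Fin (p n k)) (Fin (r k)) ℝ}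
  {F₀ : ∀ n, Fin (T n) → Tensor r}

/-- A loading matrix without columns has Frobenius norm zero, against pervasiveness. -/
lemma LoadingFactorAssumption.rank_pos (h : LoadingFactorAssumption 𝒜 ℱ T p A₀ F₀)
    (hp : ∀ k, Tendsto (fun n => p n k) atTop atTop) (k : Fin K) : 1 ≤ r k := by
  obtain ⟨a, ha, hA⟩ := h.pervasive k
  obtain ⟨n, hn⟩ := ((hp k).eventually_ge_atTop 1).exists
  by_contra hr
  have h0 : IsEmpty (Fin (r k)) := by
    rw [show r k = 0 by omega]
    infer_instance
  have h1 := hA n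
  rw [frobNorm] at h1
  simp only [Finset.univ_eq_empty, Finset.sum_empty, Finset.sum_const_zero, Real.sqrt_zero] at h1
  have h2 : (0 : ℝ) < p n k := by exact_mod_cast hn
  have := mul_pos ha (Real.sqrt_pos.2 h2)
  linarith

lemma LoadingFactorAssumption.loading (h : LoadingFactorAssumption 𝒜 ℱ T p A₀ F₀) {n : ℕ}
    {k : Fin K} (hd : 0 < p n k) : (A₀ n k)ᵀ * A₀ n k = (p n k : ℝ) • 1 := by
  have hd' : (p n k : ℝ) ≠ 0 := by exact_mod_cast hd.ne'
  rw [← (h.mem_paramSpace n).2.1 k, smul_smul, mul_one_div_cancel hd', one_smul]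

lemma LoadingFactorAssumption.exists_bounds (h : LoadingFactorAssumption 𝒜 ℱ T p A₀ F₀)
    (hr : ∀ k, 1 ≤ r k) (hK : 0 < K) : ∃ σ C₀ : ℝ, 0 < σ ∧ 0 ≤ C₀ ∧ ∀ᶠ n in atTop, ∀ k z,
      σ * (z ⬝ᵥ z) ≤ z ⬝ᵥ (factorCov (F₀ n) k *ᵥ z) ∧
      z ⬝ᵥ (factorCov (F₀ n) k *ᵥ z) ≤ C₀ * (z ⬝ᵥ z) := by
  choose Sig hSig hlim using h.factorCov_tendsto
  choose τ hτ _ hτS using hSig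
  choose φ _ _ hφ using fun n k => (h.mem_paramSpace n).2.2.2 k
  have hentry : ∀ k i, Tendsto (fun n => φ n k i) atTop (𝓝 (τ k i)) := fun k i => by
    have h1 := ((continuous_id.matrix_elem i i).tendsto (Sig k)).comp (hlim k)
    simpa [Function.comp_def, hτS k, hφ] using h1
  have : Nonempty (Σ k, Fin (r k)) := ⟨⟨⟨0, hK⟩, ⟨0, hr _⟩⟩⟩
  obtain ⟨i₀, hi₀⟩ := Finite.exists_min fun x : Σ k, Fin (r k) => τ x.1 x.2
  obtain ⟨i₁, hi₁⟩ := Finite.exists_max fun x : Σ k, Fin (r k) => τ x.1 x.2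
  have hpos₀ := hτ i₀.1 i₀.2
  have hpos₁ := hτ i₁.1 i₁.2
  -- Smallest and largest diagonal entry of all the limits, each with a factor 2 of room.
  refine ⟨τ i₀.1 i₀.2 / 2, 2 * τ i₁.1 i₁.2, by positivity, by positivity, ?_⟩
  have hev : ∀ k i, ∀ᶠ n in atTop, τ i₀.1 i₀.2 / 2 ≤ φ n k i ∧ φ n k i ≤ 2 * τ i₁.1 i₁.2 :=
    fun k i => by
      have h0 : τ i₀.1 i₀.2 ≤ τ k i := hi₀ ⟨k, i⟩
      have h1 : τ k i ≤ τ i₁.1 i₁.2 := hi₁ ⟨k, i⟩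
      exact ((hentry k i).eventually_const_le (by linarith)).and
        ((hentry k i).eventually_le_const (by linarith))
  filter_upwards [eventually_all.2 fun k => eventually_all.2 fun i => hev k i] with n hn k z
  have hform : z ⬝ᵥ (factorCov (F₀ n) k *ᵥ z) = ∑ i, φ n k i * (z i * z i) := by
    rw [hφ n k, dotProduct]
    exact Finset.sum_congr rfl fun i _ => by rw [Matrix.mulVec_diagonal]; ring
  rw [hform, dotProduct, Finset.mul_sum, Finset.mul_sum]
  exact ⟨Finset.sum_le_sum fun i _ => mul_le_mul_of_nonneg_right (hn k i).1 (mul_self_nonneg _),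
    Finset.sum_le_sum fun i _ => mul_le_mul_of_nonneg_right (hn k i).2 (mul_self_nonneg _)⟩

lemma SubGaussianErrors.exists_moments {Ω : ℕ → Type*} [∀ n, MeasurableSpace (Ω n)]
    {P : ∀ n, Measure (Ω n)} {E : ∀ n, Fin (T n) → Ω n → Tensor (p n)}
    (h : SubGaussianErrors T p P E) : ∃ s κ : ℝ, 0 < s ∧ 0 < κ ∧ ∀ n t i,
      ∫ ω, E n t ω i ^ 2 ∂(P n) ≤ s ∧ Integrable (fun ω => E n t ω i ^ 4) (P n) ∧
      ∫ ω, E n t ω i ^ 4 ∂(P n) ≤ κ := by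
  obtain ⟨ν, hν, hm⟩ := h.moments
  -- The moment constants at `d = 1` and `d = 2` are `2!/(2·1!) = 1` and `4!/(4·2!) = 3`.
  refine ⟨ν ^ 2, 3 * ν ^ 4, by positivity, by positivity, fun n t i => ?_⟩
  have h1 := hm n t i 1 le_rfl
  have h2 := hm n t i 2 (by norm_num)
  norm_num [Nat.factorial, Even.pow_abs] at h1 h2
  exact ⟨h1.2, h2⟩

end Assumptions

/-! ### Noise along the sequence of samples -/

section Limit

variable {K : ℕ} {T : ℕ → ℕ} {p : ℕ → Fin K → ℕ} {Ω : ℕ → Type*} [∀ n, MeasurableSpace (Ω n)]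
  {P : ∀ n, Measure (Ω n)} [∀ n, IsProbabilityMeasure (P n)]
  {E : ∀ n, Fin (T n) → Ω n → Tensor (p n)}

lemma tendsto_const_div_natCast {u : ℕ → ℕ} (hu : Tendsto u atTop atTop) (C : ℝ) :
    Tendsto (fun n => C / (u n : ℝ)) atTop (𝓝 0) :=
  (tendsto_natCast_atTop_atTop.comp hu).const_div_atTop C

/-- For the initial step a fixed small level suffices. Relative to `T p` the mean part is `s / p_k`,
and the exceptional probability is of order `1 / (T p_{-k})`. -/
lemma tendsto_measure_noise (hK : 2 ≤ K) (hT : Tendsto T atTop atTop)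
    (hp : ∀ k, Tendsto (fun n => p n k) atTop atTop)
    (hE : ∀ n t i, Measurable (fun ω => E n t ω i)) (h₂ : ErrorIndependence T p P E)
    (h₃ : SubGaussianErrors T p P E) {η₀ : ℝ} (hη₀ : 0 < η₀) (k : Fin K) :
    Tendsto (fun n => P n {ω | ¬ ∀ x,
      ∑ t, ((unfolding k (E n t ω))ᵀ *ᵥ x) ⬝ᵥ ((unfolding k (E n t ω))ᵀ *ᵥ x) ≤
        η₀ * (T n * fullDim (p n)) * (x ⬝ᵥ x)}) atTop (𝓝 0) := by
  obtain ⟨s, κ, hs, hκ, hm⟩ := h₃.exists_moments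
  have hlim := ENNReal.tendsto_ofReal (tendsto_const_div_natCast
    (hT.atTop_mul_atTop₀ (tendsto_coDim hK hp k)) (κ * (2 / η₀) ^ 2))
  rw [ENNReal.ofReal_zero] at hlim
  refine tendsto_of_tendsto_of_tendsto_of_le_of_le' tendsto_const_nhds hlim
    (Eventually.of_forall fun n => zero_le) ?_
  filter_upwards [hT.eventually_ge_atTop 1, (hp k).eventually_ge_atTop 1,
    (tendsto_coDim hK hp k).eventually_ge_atTop 1,
    (tendsto_const_div_natCast (hp k) s).eventually_le_const (half_pos hη₀)] with n h1 h2 h3 h4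
  have h1' : (0 : ℝ) < T n := by exact_mod_cast h1
  have h2' : (0 : ℝ) < p n k := by exact_mod_cast h2
  have h3' : (0 : ℝ) < coDim (p n) k := by exact_mod_cast h3
  have hN : (fullDim (p n) : ℝ) = p n k * coDim (p n) k := by
    exact_mod_cast fullDim_eq (p n) k
  set l : ℝ := η₀ / 2 * (T n * fullDim (p n)) with hl
  have hlpos : 0 < l := by rw [hl, hN]; positivity
  refine (measure_mono ?_).trans ((measure_noise_le (hE n) (h₂ n) (fun t i => (h₃.centred n t i).2)
    (fun t i => (hm n t i).1) (fun t i => (hm n t i).2.1) (fun t i => (hm n t i).2.2) hlpos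
    k).trans_eq ?_)
  · intro ω hω
    simp only [Set.mem_ofPred_eq, not_forall, not_le] at hω ⊢
    obtain ⟨x, hx⟩ := hω
    refine ⟨x, lt_of_le_of_lt (mul_le_mul_of_nonneg_right ?_ (dotProduct_self_nonneg x)) hx⟩
    rw [div_le_iff₀ h2'] at h4
    push_cast
    rw [hl, hN]
    nlinarith [mul_le_mul_of_nonneg_left h4 (mul_pos h1' h3').le]
  · congr 1
    rw [hl, hN]
    push_cast
    field_simp

/-- Here the level must be of order `√δ`. Relative to `T p` the mean part is `s / p_{-k}`,
negligible since `δ ≥ c / p_{-k}`; the exceptional probability is of order `1 / (δ p_k T)`, which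
vanishes since `δ ≥ c / √(p_k T)`. -/
lemma tendsto_measure_projected_noise (hK : 2 ≤ K) (hT : Tendsto T atTop atTop)
    (hp : ∀ k, Tendsto (fun n => p n k) atTop atTop)
    (hE : ∀ n t i, Measurable (fun ω => E n t ω i)) (h₂ : ErrorIndependence T p P E)
    (h₃ : SubGaussianErrors T p P E) {c : ℝ} (hc : 0 < c) {ε : ℝ} (hε : 0 < ε) (k : Fin K) :
    Tendsto (fun n => P n {ω | ¬ ∀ v,
      ∑ t, (unfolding k (E n t ω) *ᵥ v) ⬝ᵥ (unfolding k (E n t ω) *ᵥ v) ≤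
        ε * √(penalty c (T n) (p n) k) * (T n * fullDim (p n)) * (v ⬝ᵥ v)}) atTop (𝓝 0) := by
  obtain ⟨s, κ, hs, hκ, hm⟩ := h₃.exists_moments
  have hsqrt : Tendsto (fun n => √((p n k * T n : ℕ) : ℝ)) atTop atTop :=
    Real.tendsto_sqrt_atTop.comp (tendsto_natCast_atTop_atTop.comp ((hp k).atTop_mul_atTop₀ hT))
  have hco : Tendsto (fun n => √(coDim (p n) k : ℝ)) atTop atTop :=
    Real.tendsto_sqrt_atTop.comp (tendsto_natCast_atTop_atTop.comp (tendsto_coDim hK hp k))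
  have hlim := ENNReal.tendsto_ofReal (hsqrt.const_div_atTop (κ * (2 / ε) ^ 2 / c))
  rw [ENNReal.ofReal_zero] at hlim
  refine tendsto_of_tendsto_of_tendsto_of_le_of_le' tendsto_const_nhds hlim
    (Eventually.of_forall fun n => zero_le) ?_
  filter_upwards [hT.eventually_ge_atTop 1, (hp k).eventually_ge_atTop 1,
    (tendsto_coDim hK hp k).eventually_ge_atTop 1,
    (tendsto_rateOmega hK hT hp k).eventually_ge_atTop 1,
    hco.eventually_ge_atTop (2 * s / (ε * √c))] with n h1 h2 h3 h4 h5
  have h1' : (0 : ℝ) < T n := by exact_mod_cast h1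
  have h2' : (0 : ℝ) < p n k := by exact_mod_cast h2
  have h3' : (0 : ℝ) < coDim (p n) k := by exact_mod_cast h3
  have hN : (fullDim (p n) : ℝ) = p n k * coDim (p n) k := by
    exact_mod_cast fullDim_eq (p n) k
  set δ := penalty c (T n) (p n) k with hδ
  have hδpos : 0 < δ := penalty_pos hc h4
  have hsδ : 0 < √δ := Real.sqrt_pos.2 hδpos
  set l : ℝ := ε * √δ / 2 * (T n * fullDim (p n)) with hl
  have hlpos : 0 < l := by rw [hl, hN]; positivity
  refine (measure_mono ?_).trans ((measure_projected_noise_le (hE n) (h₂ n)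
    (fun t i => (h₃.centred n t i).2)
    (fun t i => (hm n t i).1) (fun t i => (hm n t i).2.1) (fun t i => (hm n t i).2.2) hlpos
    k).trans (ENNReal.ofReal_le_ofReal ?_))
  · intro ω hω
    simp only [Set.mem_ofPred_eq, not_forall, not_le] at hω ⊢
    obtain ⟨x, hx⟩ := hω
    refine ⟨x, lt_of_le_of_lt (mul_le_mul_of_nonneg_right ?_ (dotProduct_self_nonneg x)) hx⟩
    -- From `δ ≥ c / p_{-k}`, `√δ p_{-k}` is at least `√c √p_{-k}`, which diverges.
    have hkey : s ≤ ε * √δ / 2 * coDim (p n) k := by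
      have h6 : √c * √(coDim (p n) k : ℝ) ≤ √δ * coDim (p n) k := by
        have h7 := Real.sqrt_le_sqrt (div_coDim_le_penalty hc h4 h3)
        rw [Real.sqrt_div hc.le, div_le_iff₀ (Real.sqrt_pos.2 h3')] at h7
        calc √c * √(coDim (p n) k : ℝ)
            ≤ √δ * √(coDim (p n) k : ℝ) * √(coDim (p n) k : ℝ) :=
              mul_le_mul_of_nonneg_right h7 (Real.sqrt_nonneg _)
          _ = √δ * coDim (p n) k := by rw [mul_assoc, Real.mul_self_sqrt h3'.le]
      have hcs : 0 < √c := Real.sqrt_pos.2 hc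
      rw [div_le_iff₀ (by positivity)] at h5
      nlinarith [mul_le_mul_of_nonneg_left h6 hε.le]
    push_cast
    rw [hl, hN]
    nlinarith [mul_le_mul_of_nonneg_left hkey (mul_pos h1' h2').le]
  · have h6 := div_sqrt_le_penalty hc h4 (Nat.mul_pos h2 h1)
    set u := √((p n k * T n : ℕ) : ℝ) with hu
    have hu2 : u * u = p n k * T n := by
      rw [hu, Real.mul_self_sqrt (by positivity)]
      push_cast
      rfl
    have hupos : 0 < u := Real.sqrt_pos.2 (by exact_mod_cast Nat.mul_pos h2 h1)
    have h7 : ((T n * p n k : ℕ) : ℝ) * (coDim (p n) k : ℝ) ^ 2 * κ / l ^ 2 =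
        κ * (2 / ε) ^ 2 / (δ * (u * u)) := by
      have h8 : l ^ 2 = (ε / 2) ^ 2 * δ * (u * u) ^ 2 * (coDim (p n) k : ℝ) ^ 2 := by
        rw [hl, hN, hu2]
        nth_rewrite 2 [← Real.sq_sqrt hδpos.le]
        ring
      rw [h8, hu2]
      push_cast
      field_simp
    rw [h7, div_div]
    rw [div_le_iff₀ hupos] at h6
    refine div_le_div_of_nonneg_left (by positivity) (by positivity) ?_
    nlinarith [mul_le_mul_of_nonneg_right h6 hupos.le]

end Limit

/-! ### Consistency: the deterministic conditions hold with probability tending to one -/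

theorem tendsto_measure_rhat_ne {K : ℕ} (hK : 2 ≤ K) (r : Fin K → ℕ)
    (rmax : ℕ) (hrmax : ∀ k, r k < rmax) (c : ℝ) (hc : 0 < c)
    (T : ℕ → ℕ) (p : ℕ → Fin K → ℕ)
    (hT : Tendsto T atTop atTop) (hp : ∀ k, Tendsto (fun n => p n k) atTop atTop)
    (𝒜 : ∀ k, Set (Fin (r k) → ℝ)) (ℱ : Set (Tensor r))
    (A₀ : ∀ n k, Matrix (Fin (p n k)) (Fin (r k)) ℝ)
    (F₀ : ∀ n, Fin (T n) → Tensor r)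
    (Ω : ℕ → Type*) [∀ n, MeasurableSpace (Ω n)]
    (P : ∀ n, Measure (Ω n)) [∀ n, IsProbabilityMeasure (P n)]
    (E : ∀ n, Fin (T n) → Ω n → Tensor (p n))
    (hE : ∀ n t i, Measurable (fun ω => E n t ω i))
    (h₁ : LoadingFactorAssumption 𝒜 ℱ T p A₀ F₀) (h₂ : ErrorIndependence T p P E)
    (h₃ : SubGaussianErrors T p P E)
    (run : ∀ n (ω : Ω n), IPERun c rmax (observations (A₀ n) (F₀ n) (fun t => E n t ω)))
    (last : ∀ n, Ω n → ℕ) (hlast : ∀ n ω, 1 ≤ last n ω) (k : Fin K) :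
    Tendsto (fun n => P n {ω | (run n ω).rhat (last n ω) k ≠ r k}) atTop (𝓝 0) := by
  have hr := h₁.rank_pos hp
  obtain ⟨σ', C₀, hσ', hC₀, hF⟩ := h₁.exists_bounds hr (by omega)
  -- The signal strength left after `K - 1` projections.
  set σ := σ' / 2 ^ (K - 1) with hσdef
  have hσ : 0 < σ := by positivity
  set D : ℝ := ((rmax : ℝ) + 2) ^ (K - 1) with hD
  have hDpos : 0 < D := by positivity
  -- Ensures `ε² ≤ σ / 16`, so that `η² ≤ (σ / 16) δ` for `η = ε √δ`.
  set ε := min 1 (σ / 16) with hεdef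
  have hε : 0 < ε := lt_min one_pos (by positivity)
  have hε1 : ε ≤ 1 := min_le_left _ _
  have hεσ : ε ≤ σ / 16 := min_le_right _ _
  let δ : ℕ → Fin K → ℝ := fun n l => penalty c (T n) (p n) l
  let η : ℕ → Fin K → ℝ := fun n l => ε * √(δ n l)
  have hδlim : ∀ l, Tendsto (fun n => δ n l) atTop (𝓝 0) := tendsto_penalty hK hT hp c
  have hηlim : ∀ l, Tendsto (fun n => η n l) atTop (𝓝 0) := fun l => by
    simpa using ((Real.continuous_sqrt.tendsto 0).comp (hδlim l)).const_mul ε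
  have hratio : ∀ l, Tendsto (fun n => (2 * C₀ + 2 * η n l) * (η n l + δ n l)) atTop (𝓝 0) :=
    fun l => by
      simpa using (((hηlim l).const_mul 2).const_add (2 * C₀)).mul ((hηlim l).add (hδlim l))
  let B₀ : ∀ n, Fin K → Set (Ω n) := fun n l => {ω | ¬ ∀ x,
    ∑ t, ((unfolding l (E n t ω))ᵀ *ᵥ x) ⬝ᵥ ((unfolding l (E n t ω))ᵀ *ᵥ x) ≤
      σ / 8 * (T n * fullDim (p n)) * (x ⬝ᵥ x)}
  let B₁ : ∀ n, Fin K → Set (Ω n) := fun n l => {ω | ¬ ∀ v,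
    ∑ t, (unfolding l (E n t ω) *ᵥ v) ⬝ᵥ (unfolding l (E n t ω) *ᵥ v) ≤
      -- Division by `D` compensates the number of projection directions, at most `(rmax + 2) ^ (K -
      -- 1)`.
      ε / D * √(penalty c (T n) (p n) l) * (T n * fullDim (p n)) * (v ⬝ᵥ v)}
  have hlim : Tendsto (fun n => ∑ l, (P n (B₀ n l) + P n (B₁ n l))) atTop (𝓝 0) := by
    have := tendsto_finsetSum Finset.univ fun l (_ : l ∈ Finset.univ) =>
      (tendsto_measure_noise hK hT hp hE h₂ h₃ (by positivity : 0 < σ / 8) l).add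
        (tendsto_measure_projected_noise hK hT hp hE h₂ h₃ hc (div_pos hε hDpos) l)
    simpa only [add_zero, Finset.sum_const_zero] using this
  refine tendsto_of_tendsto_of_tendsto_of_le_of_le' tendsto_const_nhds hlim
    (Eventually.of_forall fun n => zero_le) ?_
  filter_upwards [hF, hT.eventually_ge_atTop 1,
    eventually_all.2 fun l => (hp l).eventually_ge_atTop rmax,
    eventually_all.2 fun l => (tendsto_rateOmega hK hT hp l).eventually_ge_atTop 1,
    eventually_all.2 fun l => (hηlim l).eventually_lt_const (by positivity : 0 < σ / 8),
    eventually_all.2 fun l => (hratio l).eventually_lt_const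
      (by positivity : 0 < σ / 4 * (σ / 4))] with n hFn hTn hpn hωn hηn hrn
  have hsub : {ω | (run n ω).rhat (last n ω) k ≠ r k} ⊆ ⋃ l, (B₀ n l ∪ B₁ n l) := by
    intro ω hω
    by_contra hnot
    simp only [Set.mem_iUnion, Set.mem_union, not_exists, not_or] at hnot
    have hB₀ := fun l => not_not.1 (hnot l).1
    have hB₁ := fun l => not_not.1 (hnot l).2
    have hδpos : ∀ l, 0 < δ n l := fun l => penalty_pos hc (hωn l)
    have hgood : IsGood rmax (A₀ n) (F₀ n) (fun t => E n t ω) (δ n) σ C₀ (fun _ => σ / 8) (η n) :=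
      { T_pos := hTn
        r_pos := hr
        r_lt := hrmax
        rmax_le := hpn
        σ_pos := hσ
        C_nonneg := hC₀
        δ_pos := hδpos
        η_nonneg := fun l => mul_nonneg hε.le (Real.sqrt_nonneg _)
        loading := fun l => h₁.loading ((hr l).trans ((hrmax l).le.trans (hpn l)))
        le_factor := fun l z => by
          rw [hσdef, div_mul_cancel₀ _ (by positivity)]
          exact (hFn l z).1
        factor_le := fun l z => (hFn l z).2
        noise₀ := hB₀
        noise := fun l v => (hB₁ l v).trans_eq (by rw [← hD, div_mul_eq_mul_div])
        η₀_le := fun l => by linarith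
        η_le := fun l => by linarith [hηn l]
        ratio₁ := fun l => by
          have hsq := Real.mul_self_sqrt (hδpos l).le
          have h1 : η n l * η n l ≤ σ / 16 * δ n l := by
            calc η n l * η n l = ε * ε * (√(δ n l) * √(δ n l)) := mul_mul_mul_comm _ _ _ _
              _ = ε * ε * δ n l := by rw [hsq]
              _ ≤ σ / 16 * δ n l :=
                mul_le_mul_of_nonneg_right (by nlinarith) (hδpos l).le
          have h2 := mul_lt_mul_of_pos_right (hηn l) (hδpos l)
          -- The two terms `η²` and `η δ` contribute at most `σ/16 + σ/8 < σ/4` times `δ`.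
          nlinarith [mul_pos hσ (hδpos l)]
        ratio₂ := hrn }
    obtain ⟨s, hs⟩ := Nat.exists_eq_add_of_le' (hlast n ω)
    exact hω (by rw [hs]; exact hgood.rhat_eq (run n ω) s k)
  calc P n {ω | (run n ω).rhat (last n ω) k ≠ r k} ≤ P n (⋃ l, (B₀ n l ∪ B₁ n l)) :=
        measure_mono hsub
    _ ≤ ∑ l, P n (B₀ n l ∪ B₁ n l) := measure_iUnion_fintype_le _ _
    _ ≤ ∑ l, (P n (B₀ n l) + P n (B₁ n l)) := Finset.sum_le_sum fun l _ => measure_union_le _ _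

end TensorFactor

end

theorem mainTheorem5 {K : ℕ} (hK : 2 ≤ K) (r : Fin K → ℕ)
    (rmax : ℕ) (hrmax : ∀ k, r k < rmax) (c : ℝ) (hc : 0 < c)
    (T : ℕ → ℕ) (p : ℕ → Fin K → ℕ)
    (hT : Tendsto T atTop atTop) (hp : ∀ k, Tendsto (fun n => p n k) atTop atTop)
    (𝒜 : ∀ k, Set (Fin (r k) → ℝ)) (ℱ : Set (TensorFactor.Tensor r))
    (A₀ : ∀ n k, Matrix (Fin (p n k)) (Fin (r k)) ℝ)
    (F₀ : ∀ n, Fin (T n) → TensorFactor.Tensor r)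
    (Ω : ℕ → Type*) [∀ n, MeasurableSpace (Ω n)]
    (P : ∀ n, Measure (Ω n)) [∀ n, IsProbabilityMeasure (P n)]
    (E : ∀ n, Fin (T n) → Ω n → TensorFactor.Tensor (p n))
    (hE : ∀ n t i, Measurable (fun ω => E n t ω i))
    (h₁ : TensorFactor.LoadingFactorAssumption 𝒜 ℱ T p A₀ F₀)
    (h₂ : TensorFactor.ErrorIndependence T p P E)
    (h₃ : TensorFactor.SubGaussianErrors T p P E)
    -- for every outcome, a run of the algorithm on the observed data
    (run : ∀ n (ω : Ω n), TensorFactor.IPERun c rmax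
      (TensorFactor.observations (A₀ n) (F₀ n) (fun t => E n t ω)))
    -- the (possibly data-dependent) sweep after which the algorithm stops
    (last : ∀ n, Ω n → ℕ) (hlast : ∀ n ω, 1 ≤ last n ω) :
    -- the second limit is the first one without reference to measurability of the estimator
    ∀ k, Tendsto (fun n => P n {ω | (run n ω).rhat (last n ω) k = r k}) atTop (𝓝 1) ∧
      Tendsto (fun n => P n {ω | (run n ω).rhat (last n ω) k ≠ r k}) atTop (𝓝 0) := by
  intro k
  have h := TensorFactor.tendsto_measure_rhat_ne hK r rmax hrmax c hc T p hT hp 𝒜 ℱ A₀ F₀ Ω P E hE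
    h₁ h₂ h₃ run last hlast k
  refine ⟨?_, h⟩
  have hlow : Tendsto (fun n => 1 - P n {ω | (run n ω).rhat (last n ω) k ≠ r k}) atTop (𝓝 1) := by
    simpa using ENNReal.Tendsto.sub tendsto_const_nhds h (Or.inl ENNReal.one_ne_top)
  refine tendsto_of_tendsto_of_tendsto_of_le_of_le hlow tendsto_const_nhds (fun n => ?_)
    fun n => prob_le_one
  -- Subadditivity of outer measure on the event and its complement needs no measurability.
  rw [tsub_le_iff_right, ← measure_univ (μ := P n)]
  refine (measure_mono fun ω _ => ?_).trans (measure_union_le _ _)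
  exact em ((run n ω).rhat (last n ω) k = r k)
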